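/- **Setting.** Let $K$ be a division ring and $V\neq K$ a total valuation ring of $K$, i.e. a subring such that for every non-zero $k\in K$ either $k\in V$ or $k^{-1}\in V$. Let $\sigma:\mathbb Q\to \mathrm{Aut}(K)$ be a group homomorphism from the additive group $\mathbb Q$, and let $K[\mathbb Q,\sigma]$ be the skew group ring, whose elements are the finite sums $\sum a_gX^g$ ($a_g\in K$, $g\in\mathbb Q$) with $X^gX^h=X^{g+h}$ and $X^ga=\sigma(g)(a)X^g$. For a subset $I\subseteq K$ write $I^{\sigma(g)}=\sigma(g)(I)$, likewise $a^{\sigma(g)}=\sigma(g)(a)$ for elements. The product $IJ$ of additive subgroups of $K$ is the set of finite sums of products $xy$ with $x\in I$, $y\in J$. The symbols $\subset,\supset$ denote strict inclusion. For a non-zero subgroup $G$ of $\mathbb Q$, a *graded extension* of $V$ in $K[G,\sigma|_G]$ is a graded subring $A=\bigoplus_{g\in G}A_gX^g$ of $K[G,\sigma|_G]$ with $A_0=V$ such that for every $g\in G$ and every non-zero $a\in K$, either $aX^g\in A$ or $(aX^g)^{-1}\in A$. It is of *Type (I)* if for all $g,h\in G$ with $g,h>0$ $$A_gA_h^{\sigma(g)}=A_{g+h}\quad\text{and}\quad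 A_{-g}(A_{-h})^{\sigma(-g)}=A_{-g-h}.$$ For an additive subgroup $I$ of $K$ let $O_l(I)=\{a\in K\mid aI\subseteq I\}$ and, with $W=O_l(I)$, let ${}^\ast I=\bigcap\{Wc\mid 0\neq c\in K,\ I\subseteq Wc\}$. Let $J(W)$ denote the Jacobson radical of a ring $W$. Let $g>0$ and let $B=\bigoplus_{i\in\mathbb Z}A_{ig}X^{ig}$ be a graded extension of $V$ in $K[X^g,X^{-g};\sigma(g)]=K[\mathbb Zg,\sigma|_{\mathbb Zg}]$. Put $W=O_l(A_g)$ and, for $i\ge 1$, $M_{ig}=A_gA_g^{\sigma(g)}\cdots A_g^{\sigma((i-1)g)}$. Then $B$ is said to be of * Type (a) if $A_g=Va=aV^{\sigma(g)}$ and $A_{-g}=V(a^{-1})^{\sigma(-g)}$ for some $0\ne a\in K$; * Type (b) if $A_g=Wa\supset aW^{\sigma(g)}$ for some $0\ne a\in K$; * Type (c) if $A_g=Wa\subset aW^{\sigma(g)}$ for some $0\ne a\in K$; * Type (d) if $A_g=Wa=aW^{\sigma(g)}$ and $A_{-g}=J(W)(a^{-1})^{\sigma(-g)}$ for some $0\neq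 a\in K$, and $J(W)^2=J(W)$; * Type (f) if ${}^\ast A_g\supset A_g$; * Type (g) if ${}^\ast A_g=A_g$ and for no integer $i\ge1$ is ${}^\ast M_{ig}$ a principal left $W$-ideal, i.e. of the form $Wc$ with $c\in K$. Let $A=\bigoplus_{r\in\mathbb Q}A_rX^r$ be a graded extension of $V$ in $K[\mathbb Q,\sigma]$, and for $r>0$ let $H_r=\bigoplus_{i\in\mathbb Z}A_{ir}X^{ir}$. For each letter $(t)\in\{(a),(b),(c),(d),(f),(g)\}$, $A$ is said to be of Type $(t)$ if, for every rational $r>0$, $H_r$ is a graded extension of $V$ of Type $(t)$ in $K[X^r,X^{-r};\sigma(r)]$. **Theorem 3.3.** Let $A=\bigoplus_{r\in\mathbb Q}A_rX^r$ be a graded extension of $V$ in $K[\mathbb Q,\sigma]$. Then the following are equivalent: 1. $A$ is of Type (I); 2. $A$ is of Type (a), Type (b), Type (c), Type (d), Type (f) or Type (g). -/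

import Mathlib

open scoped Pointwise

namespace GradedExt

section DivisionRings

variable {K : Type*} [DivisionRing K]

/-- `V` is a total valuation ring of the division ring `K`. -/
def IsTotalValuationRing (V : Subring K) : Prop :=
  ∀ k : K, k ≠ 0 → k ∈ V ∨ k⁻¹ ∈ V

/-- `I c = {x c | x ∈ I}`. -/
def rightMul (I : AddSubgroup K) (c : K) : AddSubgroup K :=
  I.map (AddMonoidHom.mulRight c)

/-- `c I = {c x | x ∈ I}`. -/
def leftMul (c : K) (I : AddSubgroup K) : AddSubgroup K :=
  I.map (AddMonoidHom.mulLeft c)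

/-- `W c`, the left `W`-submodule of `K` generated by `c`. -/
def leftPrincipal (W : Subring K) (c : K) : AddSubgroup K :=
  rightMul W.toAddSubgroup c

/-- The left order `O_l(I) = {a ∈ K | a I ⊆ I}`. -/
def leftOrder (I : AddSubgroup K) : Subring K where
  carrier := {a | ∀ x ∈ I, a * x ∈ I}
  mul_mem' {a b} ha hb x hx := by
    rw [mul_assoc]
    exact ha _ (hb x hx)
  one_mem' x hx := by simpa using hx
  add_mem' {a b} ha hb x hx := by
    rw [add_mul]
    exact I.add_mem (ha x hx) (hb x hx)
  zero_mem' x _ := by simp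
  neg_mem' {a} ha x hx := by
    rw [neg_mul]
    exact I.neg_mem (ha x hx)

/-- The star closure `*I = ⋂ {W c | I ⊆ W c, 0 ≠ c ∈ K}`, where `W = O_l(I)`. The modules `W c` are
non-zero fractional ideals, so `c = 0` does not occur. -/
def starClosure (I : AddSubgroup K) : AddSubgroup K :=
  sInf {L | ∃ c : K, c ≠ 0 ∧ L = leftPrincipal (leftOrder I) c ∧ I ≤ L}

/-- The Jacobson radical `J(W)`, as an additive subgroup of `K`. -/
def jacobsonRadical (W : Subring K) : AddSubgroup K :=
  (Submodule.toAddSubgroup (Ring.jacobson W)).map W.subtype.toAddMonoidHom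

/-- `I^τ = τ(I)` for an automorphism `τ` of `K`. -/
def conj (I : AddSubgroup K) (τ : RingAut K) : AddSubgroup K :=
  I.map (RingEquiv.toRingHom τ).toAddMonoidHom

/-- The skew group ring `K[ℚ, σ]`: finite sums `∑ a_g X^g` with `X^g a = σ(g)(a) X^g`. -/
def SkewGroupRing (_σ : Multiplicative ℚ →* RingAut K) : Type _ :=
  SkewMonoidAlgebra K (Multiplicative ℚ)

noncomputable instance (σ : Multiplicative ℚ →* RingAut K) : Ring (SkewGroupRing σ) :=
  letI : MulSemiringAction (Multiplicative ℚ) K := MulSemiringAction.compHom K σ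
  inferInstanceAs (Ring (SkewMonoidAlgebra K (Multiplicative ℚ)))

variable (σ : Multiplicative ℚ →* RingAut K)

/-- The automorphism `σ(g)`. -/
def aut (g : ℚ) : RingAut K := σ (Multiplicative.ofAdd g)

/-- The homogeneous element `a X^g`. -/
noncomputable def monomial (g : ℚ) (a : K) : SkewGroupRing σ :=
  SkewMonoidAlgebra.single (Multiplicative.ofAdd g) a

variable {σ} in
/-- The coefficient of `X^g` in `f`. -/
def coeff (f : SkewGroupRing σ) (g : ℚ) : K :=
  SkewMonoidAlgebra.coeff (k := K) (G := Multiplicative ℚ) f (Multiplicative.ofAdd g)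

theorem monomial_mul_monomial (g h : ℚ) (a b : K) :
    monomial σ g a * monomial σ h b = monomial σ (g + h) (a * aut σ g b) :=
  letI : MulSemiringAction (Multiplicative ℚ) K := MulSemiringAction.compHom K σ
  SkewMonoidAlgebra.single_mul_single (G := Multiplicative ℚ) (k := K)

theorem one_eq_monomial : (1 : SkewGroupRing σ) = monomial σ 0 1 := rfl

theorem monomial_zero (g : ℚ) : monomial σ g 0 = 0 :=
  SkewMonoidAlgebra.single_zero _

theorem monomial_add (g : ℚ) (a b : K) :
    monomial σ g (a + b) = monomial σ g a + monomial σ g b :=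
  SkewMonoidAlgebra.single_add _ _ _

theorem monomial_neg (g : ℚ) (a : K) : monomial σ g (-a) = -monomial σ g a :=
  SkewMonoidAlgebra.single_neg _ _

/-- The subring `K[G, σ|_G]` of `K[ℚ, σ]`, for a subgroup `G` of `ℚ`. For `G = ℤ r` this is
`K[X^r, X^{-r}; σ(r)]`. -/
def skewGroupSubring (G : AddSubgroup ℚ) : Subring (SkewGroupRing σ) where
  carrier := {f | ∀ g, coeff f g ≠ 0 → g ∈ G}
  mul_mem' {f f'} hf hf' g hg := by
    let _ : MulSemiringAction (Multiplicative ℚ) K := MulSemiringAction.compHom K σ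
    have h := SkewMonoidAlgebra.support_mul (k := K) (G := Multiplicative ℚ) (f := f) (g := f')
      (SkewMonoidAlgebra.mem_support_iff.2 hg)
    obtain ⟨x, hx, y, hy, hxy⟩ := Finset.mem_mul.1 h
    have hxy' : Multiplicative.toAdd x + Multiplicative.toAdd y = g :=
      congrArg Multiplicative.toAdd hxy
    rw [← hxy']
    exact G.add_mem (hf _ (SkewMonoidAlgebra.mem_support_iff.1 hx))
      (hf' _ (SkewMonoidAlgebra.mem_support_iff.1 hy))
  one_mem' g hg := by
    by_contra hn
    refine hg (Finsupp.single_eq_of_ne ?_)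
    intro h
    apply hn
    have : g = 0 := congrArg Multiplicative.toAdd h
    rw [this]
    exact G.zero_mem
  add_mem' {f f'} hf hf' g hg := by
    by_contra hn
    have h1 : coeff f g = 0 := not_not.1 fun h => hn (hf g h)
    have h2 : coeff f' g = 0 := not_not.1 fun h => hn (hf' g h)
    apply hg
    have h3 : coeff (f + f') g = coeff f g + coeff f' g :=
      DFunLike.congr_fun (SkewMonoidAlgebra.coeff_add (k := K) (G := Multiplicative ℚ) f f') _
    rw [h3, h1, h2, add_zero]
  zero_mem' g hg := absurd rfl hg
  neg_mem' {f} hf g hg := by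
    refine hf g fun h => hg ?_
    have h3 : coeff (-f) g = -coeff f g :=
      DFunLike.congr_fun (SkewMonoidAlgebra.coeff_neg (k := K) (G := Multiplicative ℚ) f) _
    rw [h3, h, neg_zero]

/-- The homogeneous component `A_g = {a ∈ K | a X^g ∈ A}`. -/
def component (A : Subring (SkewGroupRing σ)) (g : ℚ) : AddSubgroup K where
  carrier := {a | monomial σ g a ∈ A}
  add_mem' {a b} ha hb := by
    change monomial σ g (a + b) ∈ A
    rw [monomial_add]
    exact A.add_mem ha hb
  zero_mem' := by
    change monomial σ g 0 ∈ A
    rw [monomial_zero]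
    exact A.zero_mem
  neg_mem' {a} ha := by
    change monomial σ g (-a) ∈ A
    rw [monomial_neg]
    exact A.neg_mem ha

/-- `A` is a graded extension of `V` in `K[G, σ|_G]`: a graded subring of `K[G, σ|_G]` which
contains, for every non-zero homogeneous element, that element or its inverse, and with
`A_0 = V`. -/
structure IsGradedExtension (V : Subring K) (G : AddSubgroup ℚ)
    (A : Subring (SkewGroupRing σ)) : Prop where
  le : A ≤ skewGroupSubring σ G
  graded : ∀ f ∈ A, ∀ g : ℚ, monomial σ g (coeff f g) ∈ A
  total : ∀ g ∈ G, ∀ a : K, a ≠ 0 → monomial σ g a ∈ A ∨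
    ∃ y ∈ A, monomial σ g a * y = 1 ∧ y * monomial σ g a = 1
  component_zero : component σ A 0 = V.toAddSubgroup

/-- Graded extensions of Type (I) in `K[G, σ|_G]`. -/
def IsTypeI (V : Subring K) (G : AddSubgroup ℚ) (A : Subring (SkewGroupRing σ)) : Prop :=
  IsGradedExtension σ V G A ∧
    ∀ g ∈ G, ∀ h ∈ G, 0 < g → 0 < h →
      component σ A g * conj (component σ A h) (aut σ g) = component σ A (g + h) ∧
      component σ A (-g) * conj (component σ A (-h)) (aut σ (-g)) = component σ A (-g - h)

/-- `M_0 = V` and `M_{ig} = A_g A_g^{σ(g)} ⋯ A_g^{σ((i-1)g)}` for `i ≥ 1`. -/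
def powerProduct (V : Subring K) (A : Subring (SkewGroupRing σ)) (g : ℚ) : ℕ → AddSubgroup K
  | 0 => V.toAddSubgroup
  | 1 => component σ A g
  | n + 2 => powerProduct V A g (n + 1) * conj (component σ A g) (aut σ ((n + 1 : ℕ) * g))

/-! The types of a graded extension `B` of `V` in `K[X^g, X^{-g}; σ(g)]`, for `g > 0`. -/

section CyclicTypes

variable (V : Subring K) (g : ℚ) (B : Subring (SkewGroupRing σ))

/-- `A_g = V a = a V^{σ(g)}` and `A_{-g} = V (a⁻¹)^{σ(-g)}`. -/
def CyclicTypeA : Prop :=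
  IsGradedExtension σ V (AddSubgroup.zmultiples g) B ∧ ∃ a : K, a ≠ 0 ∧
    component σ B g = leftPrincipal V a ∧
    component σ B g = leftMul a (conj V.toAddSubgroup (aut σ g)) ∧
    component σ B (-g) = leftPrincipal V (aut σ (-g) a⁻¹)

/-- `A_g = W a ⊃ a W^{σ(g)}` (strict inclusion), where `W = O_l(A_g)`. -/
def CyclicTypeB : Prop :=
  IsGradedExtension σ V (AddSubgroup.zmultiples g) B ∧ ∃ a : K, a ≠ 0 ∧
    component σ B g = leftPrincipal (leftOrder (component σ B g)) a ∧
    leftMul a (conj (leftOrder (component σ B g)).toAddSubgroup (aut σ g)) < component σ B g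

/-- `A_g = W a ⊂ a W^{σ(g)}` (strict inclusion), where `W = O_l(A_g)`. -/
def CyclicTypeC : Prop :=
  IsGradedExtension σ V (AddSubgroup.zmultiples g) B ∧ ∃ a : K, a ≠ 0 ∧
    component σ B g = leftPrincipal (leftOrder (component σ B g)) a ∧
    component σ B g < leftMul a (conj (leftOrder (component σ B g)).toAddSubgroup (aut σ g))

/-- `A_g = W a = a W^{σ(g)}`, `A_{-g} = J(W) (a⁻¹)^{σ(-g)}` and `J(W)² = J(W)`, where
`W = O_l(A_g)`. -/
def CyclicTypeD : Prop :=
  IsGradedExtension σ V (AddSubgroup.zmultiples g) B ∧ ∃ a : K, a ≠ 0 ∧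
    component σ B g = leftPrincipal (leftOrder (component σ B g)) a ∧
    component σ B g = leftMul a (conj (leftOrder (component σ B g)).toAddSubgroup (aut σ g)) ∧
    component σ B (-g) =
      rightMul (jacobsonRadical (leftOrder (component σ B g))) (aut σ (-g) a⁻¹) ∧
    jacobsonRadical (leftOrder (component σ B g)) *
      jacobsonRadical (leftOrder (component σ B g)) =
        jacobsonRadical (leftOrder (component σ B g))

/-- `*A_g ⊃ A_g` (strict inclusion). -/
def CyclicTypeF : Prop :=
  IsGradedExtension σ V (AddSubgroup.zmultiples g) B ∧
    component σ B g < starClosure (component σ B g)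

/-- `*A_g = A_g` and, for every `i ≥ 1`, `*M_{ig}` is not a principal left `W`-ideal, where
`W = O_l(A_g)`. -/
def CyclicTypeG : Prop :=
  IsGradedExtension σ V (AddSubgroup.zmultiples g) B ∧
    starClosure (component σ B g) = component σ B g ∧
    ∀ i : ℕ, 1 ≤ i → ¬ ∃ c : K,
      starClosure (powerProduct σ V B g i) = leftPrincipal (leftOrder (component σ B g)) c

end CyclicTypes

/-- `H_r = ⨁_{i ∈ ℤ} A_{ir} X^{ir}`, the elements of `A` supported in `ℤ r`. -/
noncomputable def cyclicPiece (A : Subring (SkewGroupRing σ)) (r : ℚ) : Subring (SkewGroupRing σ) :=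
  A ⊓ skewGroupSubring σ (AddSubgroup.zmultiples r)

/-! The types of a graded extension `A` of `V` in `K[ℚ, σ]`: every `H_r`, `r > 0`, is of the type
with the same letter. -/

section Types

variable (V : Subring K) (A : Subring (SkewGroupRing σ))

def IsTypeA : Prop :=
  IsGradedExtension σ V ⊤ A ∧ ∀ r : ℚ, 0 < r → CyclicTypeA σ V r (cyclicPiece σ A r)

def IsTypeB : Prop :=
  IsGradedExtension σ V ⊤ A ∧ ∀ r : ℚ, 0 < r → CyclicTypeB σ V r (cyclicPiece σ A r)

def IsTypeC : Prop :=
  IsGradedExtension σ V ⊤ A ∧ ∀ r : ℚ, 0 < r → CyclicTypeC σ V r (cyclicPiece σ A r)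

def IsTypeD : Prop :=
  IsGradedExtension σ V ⊤ A ∧ ∀ r : ℚ, 0 < r → CyclicTypeD σ V r (cyclicPiece σ A r)

def IsTypeF : Prop :=
  IsGradedExtension σ V ⊤ A ∧ ∀ r : ℚ, 0 < r → CyclicTypeF σ V r (cyclicPiece σ A r)

def IsTypeG : Prop :=
  IsGradedExtension σ V ⊤ A ∧ ∀ r : ℚ, 0 < r → CyclicTypeG σ V r (cyclicPiece σ A r)

end Types

end DivisionRings

end GradedExt

/-! The non-zero homogeneous elements of `K[ℚ, σ]` form the group `Kˣ ⋊ ℚ`, and those in `A` form a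
submonoid `P` containing `x` or `x⁻¹` for every `x`. As `V` is a total valuation ring, a sum of
products in `A_g A_h^{σ(g)}` is again a single product (`exists_of_mem_mul_conj`). Addition thus
disappears: components become the pieces `P_d`, their products become set products, and the theorem
becomes `piece_mul_piece_iff`, about a total cone in a group graded by an abelian group.

From types to Type (I), the engine is `exists_of_pow_ne`. At the first power where `P_d ^ (n + 2)`
misses some `b` of degree `d ^ (n + 2)` in `P`, totality forces `P_{d ^ (n + 1)} = P_{d⁻¹} b = b
P_{d⁻¹}`. Then `P_d` has no unit, its two stabilizers agree, `P_d` and `P_{d⁻¹}` are both principal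
or both not, and `P_d ^ (n + 2) = J(W) b`. A unit excludes this for (a), unequal stabilizers for (b)
and (c), opposite principality for (d) and (f); for (g) the obstacle is that the star closure of
`J(W) b` is always principal. So all powers of `P_d` and of `P_{d⁻¹}` are full, and two positive
rationals are multiples of a common one.

From Type (I) to types, having a unit, principality of `P_d` and of `P_{d⁻¹}` and, for principal
pieces, the comparison of the stabilizers do not change when `d` is replaced by a power. Common
roots make them constant, so all degrees share one type. No further case remains: principal `P_d`
and `P_{d⁻¹}` with equal stabilizers produce a unit (`hasUnit_of_principal`), and `star_eq_iff`
separates (f) from (g). -/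

namespace TotalCone

/-! ### Pieces, stabilizers and translates in a graded group. -/

variable {Γ D : Type*} [Group Γ] [CommGroup D] (deg : Γ →* D) (P : Submonoid Γ)

/-- The elements of degree `d` of the cone `P`. -/
def piece (d : D) : Set Γ := {x | x ∈ P ∧ deg x = d}

/-- The left stabilizer of `S` in degree `1`. -/
def leftStab (S : Set Γ) : Set Γ := {x | deg x = 1 ∧ ∀ y ∈ S, x * y ∈ S}

/-- The right stabilizer of `S` in degree `1`. -/
def rightStab (S : Set Γ) : Set Γ := {x | deg x = 1 ∧ ∀ y ∈ S, y * x ∈ S}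

/-- The elements of degree `1` whose inverse is not in `W`. -/
def radical (W : Set Γ) : Set Γ := {x | deg x = 1 ∧ x⁻¹ ∉ W}

/-- `S` is a translate of its left stabilizer; equivalently, of its right stabilizer. -/
def Principal (S : Set Γ) : Prop := ∃ a ∈ S, ∀ y ∈ S, ∀ z ∈ S, y * a⁻¹ * z ∈ S

/-- `P` has an invertible element of degree `d`. -/
def HasUnit (d : D) : Prop := ∃ u ∈ P, u⁻¹ ∈ P ∧ deg u = d

/-- The intersection of the translates `W c ⊇ S` of degree `d`, `W` being the left stabilizer. -/
def star (d : D) (S : Set Γ) : Set Γ :=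
  {x | deg x = d ∧ ∀ c, deg c = d → (∀ y ∈ S, y * c⁻¹ ∈ leftStab deg S) → x * c⁻¹ ∈ leftStab deg S}

variable {deg P} {d e : D}

theorem mul_mem_piece {x y : Γ} (hx : x ∈ piece deg P d) (hy : y ∈ piece deg P e) :
    x * y ∈ piece deg P (d * e) :=
  ⟨P.mul_mem hx.1 hy.1, by rw [map_mul, hx.2, hy.2]⟩

theorem one_mem_leftStab (S : Set Γ) : (1 : Γ) ∈ leftStab deg S :=
  ⟨map_one _, fun y hy => by simpa using hy⟩

theorem mul_mem_leftStab {S : Set Γ} {x y : Γ} (hx : x ∈ leftStab deg S)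
    (hy : y ∈ leftStab deg S) : x * y ∈ leftStab deg S :=
  ⟨by rw [map_mul, hx.1, hy.1, one_mul], fun z hz => by
    rw [mul_assoc]; exact hx.2 _ (hy.2 z hz)⟩

theorem piece_one_subset_leftStab : piece deg P 1 ⊆ leftStab deg (piece deg P d) :=
  fun _ hx => ⟨hx.2, fun _ hy => by simpa using mul_mem_piece hx hy⟩

theorem piece_one_subset_rightStab : piece deg P 1 ⊆ rightStab deg (piece deg P d) :=
  fun _ hx => ⟨hx.2, fun _ hy => by simpa using mul_mem_piece hy hx⟩

theorem HasUnit.inv (h : HasUnit deg P d) : HasUnit deg P d⁻¹ := by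
  obtain ⟨u, hu, hu', rfl⟩ := h
  exact ⟨u⁻¹, hu', by simpa using hu, map_inv _ _⟩

theorem hasUnit_inv_iff : HasUnit deg P d⁻¹ ↔ HasUnit deg P d :=
  ⟨fun h => by simpa using h.inv, HasUnit.inv⟩

theorem HasUnit.pow (h : HasUnit deg P d) (n : ℕ) : HasUnit deg P (d ^ n) := by
  obtain ⟨u, hu, hu', rfl⟩ := h
  exact ⟨u ^ n, P.pow_mem hu n, by rw [← inv_pow]; exact P.pow_mem hu' n, map_pow _ _ _⟩

theorem HasUnit.principal (h : HasUnit deg P d) : Principal (piece deg P d) := by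
  obtain ⟨u, hu, hu', rfl⟩ := h
  refine ⟨u, ⟨hu, rfl⟩, fun y hy z hz => ⟨P.mul_mem (P.mul_mem hy.1 hu') hz.1, ?_⟩⟩
  rw [map_mul, map_mul, map_inv, hy.2, hz.2]
  simp

theorem inv_notMem_of_not_hasUnit (h : ¬ HasUnit deg P d) {x : Γ} (hx : x ∈ piece deg P d) :
    x⁻¹ ∉ P :=
  fun hx' => h ⟨x, hx.1, hx', hx.2⟩

theorem Principal.image_mul_left {S : Set Γ} (h : Principal S) (z : Γ) : Principal ({z} * S) := by
  obtain ⟨a, ha, h⟩ := h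
  refine ⟨z * a, Set.mul_mem_mul rfl ha, ?_⟩
  rintro _ ⟨_, rfl, y, hy, rfl⟩ _ ⟨_, rfl, w, hw, rfl⟩
  exact ⟨_, rfl, _, h y hy w hw, by simp [mul_assoc]⟩

theorem Principal.image_mul_right {S : Set Γ} (h : Principal S) (z : Γ) : Principal (S * {z}) := by
  obtain ⟨a, ha, h⟩ := h
  refine ⟨a * z, Set.mul_mem_mul ha rfl, ?_⟩
  rintro _ ⟨y, hy, _, rfl, rfl⟩ _ ⟨w, hw, _, rfl, rfl⟩
  exact ⟨_, h y hy w hw, _, rfl, by simp [mul_assoc]⟩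

theorem mem_mul_singleton_iff {S : Set Γ} {b x : Γ} : x ∈ S * {b} ↔ x * b⁻¹ ∈ S := by
  simp

theorem mem_singleton_mul_iff {S : Set Γ} {b x : Γ} : x ∈ {b} * S ↔ b⁻¹ * x ∈ S := by
  simp

theorem leftStab_mul_singleton (S : Set Γ) (b : Γ) :
    leftStab deg (S * {b}) = leftStab deg S := by
  ext x
  refine and_congr_right fun _ => ⟨fun h y hy => ?_, fun h y hy => ?_⟩
  · simpa [mul_assoc] using h (y * b) (Set.mul_mem_mul hy rfl)
  · rw [mem_mul_singleton_iff, mul_assoc]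
    exact h _ (mem_mul_singleton_iff.1 hy)

theorem mem_leftStab_singleton_mul {S : Set Γ} {b x : Γ} :
    b * x * b⁻¹ ∈ leftStab deg ({b} * S) ↔ x ∈ leftStab deg S := by
  refine and_congr (by simp) ⟨fun h y hy => ?_, fun h y hy => ?_⟩
  · simpa [mul_assoc] using h (b * y) (Set.mul_mem_mul rfl hy)
  · rw [mem_singleton_mul_iff, mul_assoc, mul_assoc, inv_mul_cancel_left]
    exact h _ (mem_singleton_mul_iff.1 hy)

/-- In degree `1`, an element stabilizes `S` exactly when its inverse is outside the radical, so the
radical determines the stabilizer. -/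
theorem leftStab_eq_of_radical_eq {S T : Set Γ}
    (h : radical deg (leftStab deg S) = radical deg (leftStab deg T)) :
    leftStab deg S = leftStab deg T := by
  have key : ∀ {S : Set Γ} {x : Γ}, x ∈ leftStab deg S ↔
      deg x = 1 ∧ x⁻¹ ∉ radical deg (leftStab deg S) := fun {S x} => by
    refine ⟨fun hx => ⟨hx.1, fun hr => hr.2 (by simpa using hx)⟩, fun hx => ?_⟩
    by_contra hn
    exact hx.2 ⟨by simp [hx.1], by simpa using hn⟩
  ext x
  rw [key, key, h]

/-! ### Consequences of totality: opposite degrees. -/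

section Total

variable (hP : ∀ x, x ∈ P ∨ x⁻¹ ∈ P)
include hP

theorem inv_mem_piece {x : Γ} (hd : deg x = d) (hx : x ∉ piece deg P d) :
    x⁻¹ ∈ piece deg P d⁻¹ :=
  ⟨(hP x).resolve_left fun h => hx ⟨h, hd⟩, by rw [map_inv, hd]⟩

/-- Without a unit, `P_{d⁻¹}` consists of the inverses of the elements of degree `d` outside `P_d`;
inversion exchanges the two sides. -/
theorem leftStab_piece_inv (h : ¬ HasUnit deg P d) :
    leftStab deg (piece deg P d⁻¹) = rightStab deg (piece deg P d) := by
  have h' : ¬ HasUnit deg P d⁻¹ := by rwa [hasUnit_inv_iff]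
  ext x
  constructor
  · rintro ⟨hx, H⟩
    refine ⟨hx, fun y hy => ?_⟩
    by_contra hn
    have := H _ (inv_mem_piece hP (by rw [map_mul, hx, hy.2, mul_one]) hn)
    rw [mul_inv_rev, mul_inv_cancel_left] at this
    exact inv_notMem_of_not_hasUnit h hy this.1
  · rintro ⟨hx, H⟩
    refine ⟨hx, fun y hy => ?_⟩
    by_contra hn
    have := inv_mem_piece hP (by rw [map_mul, hx, hy.2, one_mul]) hn
    rw [inv_inv] at this
    have := H _ this
    rw [mul_inv_rev, inv_mul_cancel_right] at this
    exact inv_notMem_of_not_hasUnit h' hy this.1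

theorem rightStab_piece_inv (h : ¬ HasUnit deg P d) :
    rightStab deg (piece deg P d⁻¹) = leftStab deg (piece deg P d) := by
  rw [← leftStab_piece_inv hP (by rwa [hasUnit_inv_iff]), inv_inv]

theorem leftStab_total {x : Γ} (hx : deg x = 1) :
    x ∈ leftStab deg (piece deg P d) ∨ x⁻¹ ∈ leftStab deg (piece deg P d) :=
  (hP x).imp (fun h => piece_one_subset_leftStab ⟨h, hx⟩)
    fun h => piece_one_subset_leftStab ⟨h, by simp [hx]⟩

/-- If `x` and `y` are in only the left and only the right stabilizer, then `x y⁻¹` or its inverse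
lies in `P_1`, hence in both stabilizers, which carries `x` or `y` into the other one. -/
theorem leftStab_rightStab_total :
    leftStab deg (piece deg P d) ⊆ rightStab deg (piece deg P d) ∨
      rightStab deg (piece deg P d) ⊆ leftStab deg (piece deg P d) := by
  by_contra! h
  obtain ⟨⟨x, hx, hx'⟩, y, hy, hy'⟩ := h.imp Set.not_subset.1 Set.not_subset.1
  rcases hP (x * y⁻¹) with h | h
  · refine hx' ⟨hx.1, fun z hz => ?_⟩
    have h1 := piece_one_subset_rightStab (deg := deg) (d := d) ⟨h, by simp [hx.1, hy.1]⟩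
    have := hy.2 _ (h1.2 z hz)
    simpa [mul_assoc] using this
  · refine hy' ⟨hy.1, fun z hz => ?_⟩
    rw [mul_inv_rev, inv_inv] at h
    have h1 := piece_one_subset_leftStab (deg := deg) (d := d) ⟨h, by simp [hx.1, hy.1]⟩
    have := h1.2 _ (hx.2 z hz)
    simpa [mul_assoc] using this

/-- If `j⁻¹` fails to stabilize `P_d`, then `j⁻¹ x ∉ P_d` for some `x ∈ P_d`; totality gives `x⁻¹ j
∈ P_{d⁻¹}`, and `j = x (x⁻¹ j)`. -/
theorem piece_mul_piece_inv (h : ¬ HasUnit deg P d) :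
    piece deg P d * piece deg P d⁻¹ = radical deg (leftStab deg (piece deg P d)) := by
  have h' : ¬ HasUnit deg P d⁻¹ := by rwa [hasUnit_inv_iff]
  ext j
  constructor
  · rintro ⟨x, hx, y, hy, rfl⟩
    refine ⟨by simp [hx.2, hy.2], fun hw => ?_⟩
    have := hw.2 x hx
    rw [mul_inv_rev, inv_mul_cancel_right] at this
    exact inv_notMem_of_not_hasUnit h' hy this.1
  · rintro ⟨hj, hj'⟩
    have : ∃ x ∈ piece deg P d, j⁻¹ * x ∉ piece deg P d := by
      by_contra! H
      exact hj' ⟨by simp [hj], H⟩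
    obtain ⟨x, hx, hx'⟩ := this
    have := inv_mem_piece hP (by simp [hj, hx.2]) hx'
    exact ⟨x, hx, _, this, by simp⟩

/-- For `x ∈ P_e` the quotient `b x⁻¹` is not in `P_d`, since `b` is no product; totality then puts
`x b⁻¹` in `P_{d⁻¹}`. -/
theorem piece_eq_mul_singleton {b : Γ} (hb : b ∈ piece deg P (d * e))
    (hb' : b ∉ piece deg P d * piece deg P e) : piece deg P e = piece deg P d⁻¹ * {b} := by
  ext x
  rw [mem_mul_singleton_iff]
  constructor
  · intro hx
    have : b * x⁻¹ ∉ piece deg P d := fun h => hb' ⟨_, h, _, hx, by simp⟩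
    simpa using inv_mem_piece hP (by simp [hb.2, hx.2]) this
  · intro hx
    simpa using mul_mem_piece hx hb

theorem piece_eq_singleton_mul {b : Γ} (hb : b ∈ piece deg P (e * d))
    (hb' : b ∉ piece deg P e * piece deg P d) : piece deg P e = {b} * piece deg P d⁻¹ := by
  ext x
  rw [mem_singleton_mul_iff]
  constructor
  · intro hx
    have : x⁻¹ * b ∉ piece deg P d := fun h => hb' ⟨_, hx, _, h, by simp⟩
    simpa using inv_mem_piece hP (by simp [hb.2, hx.2]) this
  · intro hx
    simpa [mul_comm] using mul_mem_piece hb hx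

end Total

/-! ### The first power that is not a full piece. -/

theorem pow_subset_piece (n : ℕ) : piece deg P d ^ (n + 1) ⊆ piece deg P (d ^ (n + 1)) := by
  induction n with
  | zero => simp
  | succ n ih =>
    rw [pow_succ, pow_succ d]
    rintro _ ⟨x, hx, y, hy, rfl⟩
    exact mul_mem_piece (ih hx) hy

theorem HasUnit.piece_mul_piece (h : HasUnit deg P d) :
    piece deg P (d * e) = piece deg P d * piece deg P e := by
  obtain ⟨u, hu, hu', rfl⟩ := h
  refine Set.Subset.antisymm (fun b hb => ⟨u, ⟨hu, rfl⟩, u⁻¹ * b, ?_, by simp⟩) ?_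
  · simpa using mul_mem_piece (⟨hu', map_inv _ _⟩ : u⁻¹ ∈ piece deg P (deg u)⁻¹) hb
  · rintro _ ⟨x, hx, y, hy, rfl⟩
    exact mul_mem_piece hx hy

theorem HasUnit.piece_pow (h : HasUnit deg P d) (n : ℕ) :
    piece deg P (d ^ (n + 1)) = piece deg P d ^ (n + 1) := by
  induction n with
  | zero => simp
  | succ n ih => rw [pow_succ' d, h.piece_mul_piece, ih, ← pow_succ']

/-- What the first power `n + 2` with `P_d ^ (n + 2) ≠ P_{d ^ (n + 2)}` entails. -/
theorem exists_of_pow_ne (hP : ∀ x, x ∈ P ∨ x⁻¹ ∈ P) {n : ℕ}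
    (hn : piece deg P (d ^ (n + 1)) = piece deg P d ^ (n + 1))
    (hne : piece deg P (d ^ (n + 2)) ≠ piece deg P d ^ (n + 2)) :
    ¬ HasUnit deg P d ∧ leftStab deg (piece deg P d) = rightStab deg (piece deg P d) ∧
    ∃ b, deg b = d ^ (n + 2) ∧
      piece deg P (d ^ (n + 1)) = piece deg P d⁻¹ * {b} ∧
      piece deg P (d ^ (n + 1)) = {b} * piece deg P d⁻¹ ∧
      piece deg P d ^ (n + 2) = radical deg (leftStab deg (piece deg P d)) * {b} := by
  have hu : ¬ HasUnit deg P d := fun h => hne (h.piece_pow (n + 1))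
  obtain ⟨b, hb, hb'⟩ : ∃ b ∈ piece deg P (d ^ (n + 2)), b ∉ piece deg P d ^ (n + 2) := by
    by_contra! H
    exact hne (Set.Subset.antisymm H (pow_subset_piece _))
  have h1 : piece deg P (d ^ (n + 1)) = piece deg P d⁻¹ * {b} :=
    piece_eq_mul_singleton hP (by rwa [← pow_succ']) (by rwa [hn, ← pow_succ'])
  have h2 : piece deg P (d ^ (n + 1)) = {b} * piece deg P d⁻¹ :=
    piece_eq_singleton_mul hP (by rwa [← pow_succ]) (by rwa [hn, ← pow_succ])
  have h3 : piece deg P d ^ (n + 2) = radical deg (leftStab deg (piece deg P d)) * {b} := by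
    rw [pow_succ', ← hn, h1, ← mul_assoc, piece_mul_piece_inv hP hu]
  have h4 : piece deg P d ^ (n + 2) = {b} * radical deg (leftStab deg (piece deg P d⁻¹)) := by
    have := piece_mul_piece_inv hP (d := d⁻¹) (by rwa [hasUnit_inv_iff])
    rw [inv_inv] at this
    rw [pow_succ, ← hn, h2, mul_assoc, this]
  refine ⟨hu, ?_, b, hb.2, h1, h2, h3⟩
  rw [← leftStab_piece_inv hP hu]
  apply leftStab_eq_of_radical_eq
  -- Since `P_{d⁻¹} b = b P_{d⁻¹}`, conjugation by `b` preserves the left stabilizer of `P_{d⁻¹}`.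
  -- Hence `b` can be moved across the radical in `h4`, and comparison with `h3` identifies the two
  -- radicals.
  have h5 : ∀ x, b * x * b⁻¹ ∈ leftStab deg (piece deg P d⁻¹) ↔
      x ∈ leftStab deg (piece deg P d⁻¹) := fun x => by
    have : leftStab deg (piece deg P d⁻¹) = leftStab deg ({b} * piece deg P d⁻¹) := by
      rw [← h2, h1, leftStab_mul_singleton]
    rw [← mem_leftStab_singleton_mul (S := piece deg P d⁻¹) (b := b) (x := x), ← this]
  ext x
  have h6 : x * b ∈ piece deg P d ^ (n + 2) ↔ x ∈ radical deg (leftStab deg (piece deg P d)) := by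
    rw [h3, mem_mul_singleton_iff, mul_inv_cancel_right]
  have h7 : x * b ∈ piece deg P d ^ (n + 2) ↔
      b⁻¹ * (x * b) ∈ radical deg (leftStab deg (piece deg P d⁻¹)) := by
    rw [h4, mem_singleton_mul_iff]
  rw [← h6, h7]
  refine and_congr (by simp [mul_comm]) (not_congr ?_)
  rw [← h5]
  simp [mul_assoc]

end TotalCone

/-! ### Principal sets, their powers and the star closure. -/

namespace TotalCone

variable {Γ D : Type*} [Group Γ] [CommGroup D] {deg : Γ →* D} {P : Submonoid Γ} {d e : D}

theorem leftStab_leftStab (S : Set Γ) : leftStab deg (leftStab deg S) = leftStab deg S := by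
  ext x
  refine ⟨fun hx => by simpa using hx.2 1 (one_mem_leftStab S), fun hx => ⟨hx.1, fun y hy => ?_⟩⟩
  exact mul_mem_leftStab hx hy

theorem one_mem_rightStab (S : Set Γ) : (1 : Γ) ∈ rightStab deg S :=
  ⟨map_one _, fun y hy => by simpa using hy⟩

theorem mul_mem_rightStab {S : Set Γ} {x y : Γ} (hx : x ∈ rightStab deg S)
    (hy : y ∈ rightStab deg S) : x * y ∈ rightStab deg S :=
  ⟨by rw [map_mul, hx.1, hy.1, one_mul], fun z hz => by
    rw [← mul_assoc]; exact hy.2 _ (hx.2 z hz)⟩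

theorem rightStab_rightStab (S : Set Γ) : rightStab deg (rightStab deg S) = rightStab deg S := by
  ext x
  refine ⟨fun hx => by simpa using hx.2 1 (one_mem_rightStab S), fun hx => ⟨hx.1, fun y hy => ?_⟩⟩
  exact mul_mem_rightStab hy hx

theorem rightStab_singleton_mul (S : Set Γ) (b : Γ) :
    rightStab deg ({b} * S) = rightStab deg S := by
  ext x
  refine and_congr_right fun _ => ⟨fun h y hy => ?_, fun h y hy => ?_⟩
  · simpa [mul_assoc] using h (b * y) (Set.mul_mem_mul rfl hy)
  · rw [mem_singleton_mul_iff, ← mul_assoc]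
    exact h _ (mem_singleton_mul_iff.1 hy)

theorem principal_leftStab (S : Set Γ) : Principal (leftStab deg S) :=
  ⟨1, one_mem_leftStab S, fun y hy z hz => by simpa using mul_mem_leftStab hy hz⟩

theorem principal_rightStab (S : Set Γ) : Principal (rightStab deg S) :=
  ⟨1, one_mem_rightStab S, fun y hy z hz => by simpa using mul_mem_rightStab hy hz⟩

theorem principal_mul_singleton_iff {S : Set Γ} {b : Γ} :
    Principal (S * {b}) ↔ Principal S := by
  refine ⟨fun h => ?_, fun h => h.image_mul_right b⟩
  have := h.image_mul_right b⁻¹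
  rwa [mul_assoc, Set.singleton_mul_singleton, mul_inv_cancel, Set.singleton_one, mul_one] at this

theorem leftStab_subset_leftStab_pow (S : Set Γ) (n : ℕ) :
    leftStab deg S ⊆ leftStab deg (S ^ (n + 1)) := by
  refine fun x hx => ⟨hx.1, ?_⟩
  rw [pow_succ']
  rintro _ ⟨y, hy, z, hz, rfl⟩
  exact ⟨_, hx.2 y hy, z, hz, mul_assoc _ _ _⟩

theorem rightStab_subset_rightStab_pow (S : Set Γ) (n : ℕ) :
    rightStab deg S ⊆ rightStab deg (S ^ (n + 1)) := by
  refine fun x hx => ⟨hx.1, ?_⟩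
  rw [pow_succ]
  rintro _ ⟨y, hy, z, hz, rfl⟩
  exact ⟨y, hy, _, hx.2 z hz, (mul_assoc _ _ _).symm⟩

section Pow

variable {S : Set Γ} (hd : ∀ y ∈ S, deg y = d) {a : Γ} (ha : a ∈ S)
  (h : ∀ y ∈ S, ∀ z ∈ S, y * a⁻¹ * z ∈ S)
include hd ha h

theorem mem_iff_mul_inv_mem_leftStab {y : Γ} : y ∈ S ↔ y * a⁻¹ ∈ leftStab deg S :=
  ⟨fun hy => ⟨by simp [hd _ hy, hd _ ha], h y hy⟩, fun hy => by simpa using hy.2 a ha⟩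

theorem mem_iff_inv_mul_mem_rightStab {y : Γ} : y ∈ S ↔ a⁻¹ * y ∈ rightStab deg S :=
  ⟨fun hy => ⟨by simp [hd _ hy, hd _ ha], fun z hz => by simpa [mul_assoc] using h z hz y hy⟩,
    fun hy => by simpa using hy.2 a ha⟩

theorem eq_leftStab_mul_singleton : S = leftStab deg S * {a} := by
  ext y
  rw [mem_mul_singleton_iff, mem_iff_mul_inv_mem_leftStab hd ha h]

theorem eq_singleton_mul_rightStab : S = {a} * rightStab deg S := by
  ext y
  rw [mem_singleton_mul_iff, mem_iff_inv_mul_mem_rightStab hd ha h]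

/-- With `S = W a`, the inclusion amounts to `a W a⁻¹ ⊆ W`, so all factors `a` can be collected on
the right. -/
theorem pow_eq_leftStab_mul_singleton (hle : leftStab deg S ⊆ rightStab deg S) (n : ℕ) :
    S ^ (n + 1) = leftStab deg S * {a ^ (n + 1)} := by
  have hc : ∀ x ∈ leftStab deg S, a * x * a⁻¹ ∈ leftStab deg S := fun x hx =>
    (mem_iff_mul_inv_mem_leftStab hd ha h).1 ((hle hx).2 a ha)
  have hc' : ∀ n : ℕ, ∀ x ∈ leftStab deg S, a ^ n * x * (a ^ n)⁻¹ ∈ leftStab deg S := by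
    intro n
    induction n with
    | zero => simp
    | succ n ih =>
      intro x hx
      have := hc _ (ih x hx)
      rw [pow_succ']
      simpa [mul_assoc] using this
  induction n with
  | zero => simpa using eq_leftStab_mul_singleton hd ha h
  | succ n ih =>
    rw [pow_succ, ih]
    ext x
    rw [mem_mul_singleton_iff]
    constructor
    · rintro ⟨_, ⟨y, hy, _, rfl, rfl⟩, z, hz, rfl⟩
      have := mul_mem_leftStab hy (hc' (n + 1) _ ((mem_iff_mul_inv_mem_leftStab hd ha h).1 hz))
      rw [pow_succ a (n + 1)]
      simpa [mul_assoc] using this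
    · intro hx
      exact ⟨_, Set.mul_mem_mul hx (Set.mem_singleton _), a, ha, by
        rw [pow_succ a (n + 1)]; simp [mul_assoc]⟩

theorem pow_eq_singleton_mul_rightStab (hle : rightStab deg S ⊆ leftStab deg S) (n : ℕ) :
    S ^ (n + 1) = {a ^ (n + 1)} * rightStab deg S := by
  have hc : ∀ x ∈ rightStab deg S, a⁻¹ * x * a ∈ rightStab deg S := fun x hx => by
    rw [mul_assoc]
    exact (mem_iff_inv_mul_mem_rightStab hd ha h).1 ((hle hx).2 a ha)
  have hc' : ∀ n : ℕ, ∀ x ∈ rightStab deg S, (a ^ n)⁻¹ * x * a ^ n ∈ rightStab deg S := by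
    intro n
    induction n with
    | zero => simp
    | succ n ih =>
      intro x hx
      have := hc _ (ih x hx)
      rw [pow_succ]
      simpa [mul_assoc] using this
  induction n with
  | zero => simpa using eq_singleton_mul_rightStab hd ha h
  | succ n ih =>
    rw [pow_succ', ih]
    ext x
    rw [mem_singleton_mul_iff]
    constructor
    · rintro ⟨z, hz, _, ⟨_, rfl, y, hy, rfl⟩, rfl⟩
      have := mul_mem_rightStab (hc' (n + 1) _ ((mem_iff_inv_mul_mem_rightStab hd ha h).1 hz)) hy
      rw [pow_succ' a (n + 1)]
      simpa [mul_assoc] using this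
    · intro hx
      exact ⟨a, ha, _, Set.mul_mem_mul (Set.mem_singleton _) hx, by
        rw [pow_succ' a (n + 1)]; simp [mul_assoc]⟩

end Pow

theorem leftStab_pow {S : Set Γ} (hd : ∀ y ∈ S, deg y = d) (h : Principal S)
    (hle : leftStab deg S ⊆ rightStab deg S) (n : ℕ) :
    leftStab deg (S ^ (n + 1)) = leftStab deg S := by
  obtain ⟨a, ha, h⟩ := h
  rw [pow_eq_leftStab_mul_singleton hd ha h hle, leftStab_mul_singleton, leftStab_leftStab]

theorem rightStab_pow {S : Set Γ} (hd : ∀ y ∈ S, deg y = d) (h : Principal S)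
    (hle : rightStab deg S ⊆ leftStab deg S) (n : ℕ) :
    rightStab deg (S ^ (n + 1)) = rightStab deg S := by
  obtain ⟨a, ha, h⟩ := h
  rw [pow_eq_singleton_mul_rightStab hd ha h hle, rightStab_singleton_mul, rightStab_rightStab]

theorem subset_star {S : Set Γ} (hd : ∀ y ∈ S, deg y = d) : S ⊆ star deg d S :=
  fun y hy => ⟨hd y hy, fun _ _ h => h y hy⟩

theorem leftStab_radical (S : Set Γ) :
    leftStab deg (radical deg (leftStab deg S)) = leftStab deg S := by
  ext x
  constructor
  · intro hx
    by_contra hn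
    have := hx.2 x⁻¹ ⟨by simp [hx.1], by simpa using hn⟩
    rw [mul_inv_cancel] at this
    exact this.2 (by simpa using one_mem_leftStab S)
  · refine fun hx => ⟨hx.1, fun j hj => ⟨by simp [hx.1, hj.1], fun h => hj.2 ?_⟩⟩
    simpa using mul_mem_leftStab h hx

/-- A unit `u = x y` with `x ∈ P_d` and `y ∈ P` has `x⁻¹ = y u⁻¹ ∈ P`, so `x` is itself a unit. -/
theorem hasUnit_pow_iff {n : ℕ} (h : piece deg P (d ^ (n + 1)) = piece deg P d ^ (n + 1)) :
    HasUnit deg P (d ^ (n + 1)) ↔ HasUnit deg P d := by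
  refine ⟨?_, fun h => h.pow _⟩
  rintro ⟨u, hu, hu', hd⟩
  have hu1 : u ∈ piece deg P d ^ (n + 1) := h ▸ ⟨hu, hd⟩
  rw [pow_succ'] at hu1
  obtain ⟨x, hx, y, hy, rfl⟩ := hu1
  have hyP : y ∈ P := by
    cases n with
    | zero =>
      rw [pow_zero, Set.mem_one] at hy
      rw [hy]
      exact P.one_mem
    | succ n => exact (pow_subset_piece n hy).1
  exact ⟨x, hx.1, by simpa using P.mul_mem hyP hu', hx.2⟩

section Total

variable (hP : ∀ x, x ∈ P ∨ x⁻¹ ∈ P)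
include hP

theorem Principal.pow (h : Principal (piece deg P d)) (n : ℕ) :
    Principal (piece deg P d ^ (n + 1)) := by
  obtain ⟨a, ha, h⟩ := h
  rcases leftStab_rightStab_total (deg := deg) (d := d) hP with hle | hle
  · rw [pow_eq_leftStab_mul_singleton (fun y hy => hy.2) ha h hle]
    exact (principal_leftStab _).image_mul_right _
  · rw [pow_eq_singleton_mul_rightStab (fun y hy => hy.2) ha h hle]
    exact (principal_rightStab _).image_mul_left _

/-- Write the generator of the top power as `x y` with `x ∈ P_d`. If the top left stabilizer is no
larger than that of `P_d`, then `x` generates `P_d`. Otherwise some stabilizing `w` has `w p ∉ P_d`,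
and translating by `(w p)⁻¹` makes the previous power principal. -/
theorem principal_of_principal_pow {n : ℕ}
    (h : ∀ k ≤ n, piece deg P (d ^ (k + 1)) = piece deg P d ^ (k + 1))
    (hn : Principal (piece deg P (d ^ (n + 1)))) : Principal (piece deg P d) := by
  induction n with
  | zero => simpa using hn
  | succ n ih =>
    have hmul : piece deg P (d ^ (n + 2)) = piece deg P d * piece deg P (d ^ (n + 1)) := by
      rw [h (n + 1) le_rfl, h n (Nat.le_succ n), ← pow_succ']
    by_cases hW : leftStab deg (piece deg P (d ^ (n + 2))) ⊆ leftStab deg (piece deg P d)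
    · obtain ⟨a, ha, hpr⟩ := hn
      have ha' := ha
      rw [hmul] at ha'
      obtain ⟨x, hx, y, hy, rfl⟩ := ha'
      refine ⟨x, hx, fun u hu v hv => ?_⟩
      have huy : u * y ∈ piece deg P (d ^ (n + 2)) := hmul ▸ Set.mul_mem_mul hu hy
      refine (hW ⟨by simp [hu.2, hx.2], fun z hz => ?_⟩).2 v hv
      simpa [mul_assoc] using hpr _ huy z hz
    · obtain ⟨w, hw, hw'⟩ := Set.not_subset.1 hW
      have : ∃ p ∈ piece deg P d, w * p ∉ piece deg P d := by
        by_contra! H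
        exact hw' ⟨hw.1, H⟩
      obtain ⟨p, hp, hwp⟩ := this
      refine ih (fun k hk => h k (hk.trans (Nat.le_succ n))) ?_
      have hz := inv_mem_piece hP (by simp [hw.1, hp.2]) hwp
      have : piece deg P (d ^ (n + 1)) = {(w * p)⁻¹} * piece deg P (d ^ (n + 2)) := by
        ext x
        rw [mem_singleton_mul_iff, inv_inv]
        constructor
        · intro hx
          rw [mul_assoc]
          exact hw.2 _ (hmul ▸ Set.mul_mem_mul hp hx)
        · intro hx
          have := mul_mem_piece hz hx
          rwa [inv_mul_cancel_left, pow_succ', inv_mul_cancel_left] at this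
      rw [this]
      exact hn.image_mul_left _

theorem principal_pow_iff {n : ℕ}
    (h : ∀ k ≤ n, piece deg P (d ^ (k + 1)) = piece deg P d ^ (k + 1)) :
    Principal (piece deg P (d ^ (n + 1))) ↔ Principal (piece deg P d) :=
  ⟨principal_of_principal_pow hP h, fun hd => by rw [h n le_rfl]; exact hd.pow hP n⟩

/-! ### Criteria for all powers of a piece to be full. -/

theorem piece_pow_of_ne (h : HasUnit deg P d ∨
      leftStab deg (piece deg P d) ≠ rightStab deg (piece deg P d) ∨
      ¬ (Principal (piece deg P d) ↔ Principal (piece deg P d⁻¹))) (n : ℕ) :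
    piece deg P (d ^ (n + 1)) = piece deg P d ^ (n + 1) := by
  induction n using Nat.strong_induction_on with
  | _ n ih =>
    cases n with
    | zero => simp
    | succ n =>
      by_contra hne
      have ih' : ∀ k ≤ n, piece deg P (d ^ (k + 1)) = piece deg P d ^ (k + 1) :=
        fun k hk => ih k (Nat.lt_succ_of_le hk)
      obtain ⟨hu, hW, b, -, hb, -, -⟩ := exists_of_pow_ne hP (ih' n le_rfl) hne
      rcases h with h | h | h
      · exact hu h
      · exact h hW
      · refine h ?_
        rw [← principal_pow_iff hP ih', hb, principal_mul_singleton_iff]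

theorem piece_inv_pow_of_ne (h : HasUnit deg P d ∨
      leftStab deg (piece deg P d) ≠ rightStab deg (piece deg P d) ∨
      ¬ (Principal (piece deg P d) ↔ Principal (piece deg P d⁻¹))) (n : ℕ) :
    piece deg P (d⁻¹ ^ (n + 1)) = piece deg P d⁻¹ ^ (n + 1) := by
  refine piece_pow_of_ne hP ?_ n
  by_cases hu : HasUnit deg P d
  · exact Or.inl hu.inv
  -- The hypothesis is symmetric under `d ↦ d⁻¹`: without a unit, inversion swaps the two
  -- stabilizers.
  · rw [leftStab_piece_inv hP hu, rightStab_piece_inv hP hu, inv_inv, hasUnit_inv_iff]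
    exact h.imp_right (Or.imp Ne.symm fun h h' => h h'.symm)

/-- If `P_d` is not principal, the inverse of a generator of `P_{d⁻¹}` lies in the star closure but
not in `P_d`. Conversely, the inverse of any element of the star closure outside `P_d` generates
`P_{d⁻¹}`. -/
theorem star_eq_iff : star deg d (piece deg P d) = piece deg P d ↔
    ¬ (¬ Principal (piece deg P d) ∧ Principal (piece deg P d⁻¹)) := by
  constructor
  · rintro h ⟨hn, b, hb, hpr⟩
    have hu : ¬ HasUnit deg P d := fun h => hn h.principal
    have hbd : deg b⁻¹ = d := by rw [map_inv, hb.2, inv_inv]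
    have hb' : b⁻¹ ∉ piece deg P d := fun h' => hu ⟨b⁻¹, h'.1, by simpa using hb.1, hbd⟩
    refine hb' (h ▸ ⟨hbd, fun c hc hsub => ⟨by simp [hb.2, hc], fun p hp => ?_⟩⟩)
    have hcn : c ∉ piece deg P d := fun hcm => hn ⟨c, hcm, fun y hy z hz => (hsub y hy).2 z hz⟩
    by_contra hx
    have h1 := inv_mem_piece hP (by simp [hb.2, hc, hp.2]) hx
    have h2 := hpr _ h1 _ (inv_mem_piece hP hc hcn)
    rw [mul_inv_rev, mul_inv_rev, inv_inv, inv_inv] at h2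
    have h3 : p⁻¹ * (c * b) * b⁻¹ * c⁻¹ = p⁻¹ := by group
    rw [h3] at h2
    exact inv_notMem_of_not_hasUnit hu hp h2.1
  · intro h
    refine Set.Subset.antisymm (fun x hx => ?_) (subset_star fun y hy => hy.2)
    by_contra hxP
    refine h ⟨fun ⟨a, ha, hpr⟩ => hxP ?_, x⁻¹, inv_mem_piece hP hx.1 hxP, fun y hy z hz => ?_⟩
    · rw [mem_iff_mul_inv_mem_leftStab (fun y hy => hy.2) ha hpr]
      exact hx.2 a ha.2 fun y hy => (mem_iff_mul_inv_mem_leftStab (fun y hy => hy.2) ha hpr).1 hy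
    · by_contra hyz
      have hu : ¬ HasUnit deg P d := by
        intro hu
        obtain ⟨a, ha, hpr⟩ := hu.principal
        apply hxP
        rw [mem_iff_mul_inv_mem_leftStab (fun y hy => hy.2) ha hpr]
        exact hx.2 a ha.2 fun y hy => (mem_iff_mul_inv_mem_leftStab (fun y hy => hy.2) ha hpr).1 hy
      have hu' : ¬ HasUnit deg P d⁻¹ := by rwa [hasUnit_inv_iff]
      have h1 := inv_mem_piece hP (by simp [hx.1, hy.2, hz.2]) hyz
      have hzd : deg z⁻¹ = d := by rw [map_inv, hz.2, inv_inv]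
      have hzP : z⁻¹ ∉ P := inv_notMem_of_not_hasUnit hu' hz
      -- The test translate is `W z⁻¹`. It contains `P_d`, since `(p z)⁻¹ ∈ P` would give `z⁻¹ = (p
      -- z)⁻¹ p ∈ P`.
      have h2 := hx.2 z⁻¹ hzd fun p hp => by
        refine piece_one_subset_leftStab ⟨(hP _).resolve_right fun hn => hzP ?_, by
          simp [hp.2, hz.2]⟩
        simpa using P.mul_mem hn hp.1
      rw [inv_inv] at h2
      rw [inv_inv] at h1
      have h3 := h2.2 _ h1
      have h4 : x * z * (y * x * z)⁻¹ = y⁻¹ := by group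
      rw [inv_inv, h4] at h3
      exact inv_notMem_of_not_hasUnit hu' hy h3.1

/-- If some `c` in the radical `J` satisfies `J ⊆ W c`, the closure is `W c b`. Otherwise every `W
c'` containing `J b` already contains `b`, and the closure is `W b`. -/
theorem exists_star_radical_mul_singleton {b : Γ} (hb : deg b = e) :
    ∃ c, star deg e (radical deg (leftStab deg (piece deg P d)) * {b}) =
      leftStab deg (piece deg P d) * {c} := by
  have hW := (leftStab_mul_singleton _ b).trans (leftStab_radical (deg := deg) (piece deg P d))
  set W := leftStab deg (piece deg P d) with hWdef
  by_cases hc : ∃ c ∈ radical deg W, ∀ j ∈ radical deg W, j * c⁻¹ ∈ W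
  · obtain ⟨c, hcJ, hc⟩ := hc
    refine ⟨c * b, Set.Subset.antisymm (fun x hx => ?_) (fun x hx => ?_)⟩
    · rw [mem_mul_singleton_iff]
      rw [← hW]
      refine hx.2 _ (by simp [hcJ.1, hb]) fun y hy => ?_
      rw [hW]
      rw [mem_mul_singleton_iff] at hy
      simpa [mul_assoc] using hc _ hy
    · rw [mem_mul_singleton_iff] at hx
      refine subset_star ?_ ?_
      · rintro _ ⟨j, hj, _, rfl, rfl⟩
        simp [hj.1, hb]
      · rw [mem_mul_singleton_iff]
        rw [← leftStab_radical (deg := deg) (piece deg P d)] at hWdef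
        rw [hWdef] at hx
        simpa [mul_assoc] using hx.2 c hcJ
  · refine ⟨b, Set.Subset.antisymm (fun x hx => ?_) (fun x hx => ?_)⟩
    · rw [mem_mul_singleton_iff, ← hW]
      refine hx.2 _ hb fun y hy => ?_
      rw [mem_mul_singleton_iff] at hy
      rw [hW]
      exact (leftStab_total hP hy.1).resolve_right hy.2
    · rw [mem_mul_singleton_iff] at hx
      refine ⟨by simpa [hb, mul_inv_eq_one] using hx.1, fun c' hc' hsub => ?_⟩
      rw [hW] at hsub ⊢
      have : b * c'⁻¹ ∈ W := by
        by_contra hn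
        refine hc ⟨c' * b⁻¹, ⟨by simp [hb, hc'], by simpa using hn⟩, fun j hj => ?_⟩
        simpa [mul_assoc] using hsub (j * b) (Set.mul_mem_mul hj rfl)
      simpa [mul_assoc] using mul_mem_leftStab hx this

theorem not_principal_of_star (h : ¬ ∃ c, star deg d (piece deg P d) =
    leftStab deg (piece deg P d) * {c}) : ¬ Principal (piece deg P d) := by
  intro hpr
  rw [star_eq_iff hP |>.2 fun h => h.1 hpr] at h
  obtain ⟨a, ha, hpr⟩ := hpr
  exact h ⟨a, eq_leftStab_mul_singleton (fun y hy => hy.2) ha hpr⟩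

section Star

variable (h : ∀ n : ℕ, ¬ ∃ c, star deg (d ^ (n + 1)) (piece deg P d ^ (n + 1)) =
  leftStab deg (piece deg P d) * {c})
include h

theorem piece_pow_of_star (n : ℕ) : piece deg P (d ^ (n + 1)) = piece deg P d ^ (n + 1) := by
  induction n with
  | zero => simp
  | succ n ih =>
    by_contra hne
    obtain ⟨-, -, b, hbd, -, -, hb⟩ := exists_of_pow_ne hP ih hne
    apply h (n + 1)
    rw [hb]
    exact exists_star_radical_mul_singleton hP hbd

/-- A failure in degree `d⁻¹` also constrains `P_d`: the product of `P_{d⁻¹ ^ (n + 1)} = b P_d` with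
its opposite piece is `b P_d ^ (n + 2)`, and it is also the radical of `W`. As `b` normalizes `W`,
this gives `P_d ^ (n + 2) = J(W) b⁻¹`, whose star closure is principal. -/
theorem piece_inv_pow_of_star (n : ℕ) :
    piece deg P (d⁻¹ ^ (n + 1)) = piece deg P d⁻¹ ^ (n + 1) := by
  have hnp : ¬ Principal (piece deg P d) := not_principal_of_star hP (by simpa using h 0)
  induction n with
  | zero => simp
  | succ n ih =>
    by_contra hne
    obtain ⟨-, -, b, hbd, hb, hb', -⟩ := exists_of_pow_ne hP ih hne
    rw [inv_inv] at hb hb'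
    have hu : ¬ HasUnit deg P (d⁻¹ ^ (n + 1)) := fun hu => hnp <| by
      have := hu.principal
      rwa [hb, principal_mul_singleton_iff] at this
    have hW : leftStab deg (piece deg P (d⁻¹ ^ (n + 1))) = leftStab deg (piece deg P d) := by
      rw [hb, leftStab_mul_singleton]
    have h1 := piece_mul_piece_inv hP hu
    rw [inv_pow, inv_inv, piece_pow_of_star hP h n, ← inv_pow, hW, hb', mul_assoc,
      ← pow_succ'] at h1
    have h2 : ∀ x, b * x * b⁻¹ ∈ leftStab deg (piece deg P d) ↔
        x ∈ leftStab deg (piece deg P d) := fun x => by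
      have : leftStab deg (piece deg P d) = leftStab deg ({b} * piece deg P d) := by
        rw [← hb', hW]
      rw [← mem_leftStab_singleton_mul (S := piece deg P d) (b := b) (x := x), ← this]
    have h3 : piece deg P d ^ (n + 2) =
        radical deg (leftStab deg (piece deg P d)) * {b⁻¹} := by
      ext x
      rw [mem_mul_singleton_iff, inv_inv]
      have : x ∈ piece deg P d ^ (n + 2) ↔ b * x ∈ radical deg (leftStab deg (piece deg P d)) := by
        rw [← h1, mem_singleton_mul_iff, inv_mul_cancel_left]
      rw [this]
      refine and_congr (by simp [mul_comm]) (not_congr ?_)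
      rw [← h2 (x * b)⁻¹]
      simp
    apply h (n + 1)
    rw [h3]
    exact exists_star_radical_mul_singleton hP (by simp [hbd])

end Star

/-- For generators `a` of `P_d` and `b` of `P_{d⁻¹}`, either `b a⁻¹` or `a b⁻¹` lies in `P`, hence
is a product `u v` from the matching squared piece. In the first case `b⁻¹ u` is in the common
stabilizer, so `a⁻¹ = b⁻¹ u v ∈ P`; the second is symmetric. -/
theorem hasUnit_of_principal (h : piece deg P (d ^ 2) = piece deg P d ^ 2)
    (h' : piece deg P (d⁻¹ ^ 2) = piece deg P d⁻¹ ^ 2) (hpr : Principal (piece deg P d))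
    (hpr' : Principal (piece deg P d⁻¹))
    (hW : leftStab deg (piece deg P d) = rightStab deg (piece deg P d)) : HasUnit deg P d := by
  by_contra hu
  have hu' : ¬ HasUnit deg P d⁻¹ := by rwa [hasUnit_inv_iff]
  have hW1 := leftStab_piece_inv hP hu
  have hW2 := rightStab_piece_inv hP hu
  obtain ⟨a, ha, hpr⟩ := hpr
  obtain ⟨b, hb, hpr'⟩ := hpr'
  by_cases hy : b * a⁻¹ ∈ piece deg P (d⁻¹ ^ 2)
  · rw [h', sq] at hy
    obtain ⟨u, hu1, v, hv, huv⟩ := hy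
    have h1 := (mem_iff_inv_mul_mem_rightStab (fun y hy => hy.2) hb hpr').1 hu1
    rw [hW2, hW, ← hW1] at h1
    have h2 := h1.2 v hv
    have h3 : b⁻¹ * u * v = a⁻¹ := by
      rw [mul_assoc]; exact inv_mul_eq_of_eq_mul huv
    rw [h3] at h2
    exact inv_notMem_of_not_hasUnit hu ha h2.1
  · have := inv_mem_piece hP (by simp [ha.2, hb.2, sq]) hy
    rw [mul_inv_rev, inv_inv, inv_pow, inv_inv, h, sq] at this
    obtain ⟨u, hu1, v, hv, huv⟩ := this
    have h1 := (mem_iff_inv_mul_mem_rightStab (fun y hy => hy.2) ha hpr).1 hu1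
    rw [← hW] at h1
    have h2 := h1.2 v hv
    have h3 : a⁻¹ * u * v = b⁻¹ := by
      rw [mul_assoc]; exact inv_mul_eq_of_eq_mul huv
    rw [h3] at h2
    exact inv_notMem_of_not_hasUnit hu' hb h2.1

end Total

/-- The types of the piece of degree `d`. -/
inductive Kind
  | a | b | c | d | f | g

variable (deg P) in
/-- The homogeneous elements of degree in `d ^ ℤ` form a cone of the given type. -/
def IsKind (d : D) : Kind → Prop
  | .a => HasUnit deg P d
  | .b => Principal (piece deg P d) ∧
      leftStab deg (piece deg P d) ⊂ rightStab deg (piece deg P d)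
  | .c => Principal (piece deg P d) ∧
      rightStab deg (piece deg P d) ⊂ leftStab deg (piece deg P d)
  | .d => Principal (piece deg P d) ∧ ¬ Principal (piece deg P d⁻¹) ∧
      leftStab deg (piece deg P d) = rightStab deg (piece deg P d)
  | .f => ¬ Principal (piece deg P d) ∧ Principal (piece deg P d⁻¹)
  | .g => star deg d (piece deg P d) = piece deg P d ∧
      ∀ n : ℕ, ¬ ∃ c, star deg (d ^ (n + 1)) (piece deg P d ^ (n + 1)) =
        leftStab deg (piece deg P d) * {c}

/-! ### Classification of the kinds. -/

section Total

variable (hP : ∀ x, x ∈ P ∨ x⁻¹ ∈ P)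
include hP

theorem IsKind.piece_pow {t : Kind} (h : IsKind deg P d t) (n : ℕ) :
    piece deg P (d ^ (n + 1)) = piece deg P d ^ (n + 1) ∧
      piece deg P (d⁻¹ ^ (n + 1)) = piece deg P d⁻¹ ^ (n + 1) := by
  have key := fun (h : HasUnit deg P d ∨
      leftStab deg (piece deg P d) ≠ rightStab deg (piece deg P d) ∨
      ¬ (Principal (piece deg P d) ↔ Principal (piece deg P d⁻¹))) => And.intro (piece_pow_of_ne (d := d) hP h n) (piece_inv_pow_of_ne hP h n)
  cases t with
  | a => exact key (Or.inl h)
  | b => exact key (Or.inr (Or.inl h.2.ne))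
  | c => exact key (Or.inr (Or.inl h.2.ne'))
  | d => exact key (Or.inr (Or.inr fun h' => h.2.1 (h'.1 h.1)))
  | f => exact key (Or.inr (Or.inr fun h' => h.1 (h'.2 h.2)))
  | g => exact ⟨piece_pow_of_star hP h.2 n, piece_inv_pow_of_star hP h.2 n⟩

/-- The pieces of degree in `s`, and those of degree in `s⁻¹`, multiply to full pieces if and only
if all degrees in `s` are of the same kind. -/
theorem piece_mul_piece_iff {s : Set D} (hne : s.Nonempty)
    (hs : ∀ d ∈ s, ∀ n : ℕ, d ^ (n + 1) ∈ s)
    (hdiv : ∀ d ∈ s, ∀ e ∈ s, ∃ f ∈ s, ∃ m n : ℕ, d = f ^ (m + 1) ∧ e = f ^ (n + 1)) :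
    (∀ d ∈ s, ∀ e ∈ s, piece deg P d * piece deg P e = piece deg P (d * e) ∧
      piece deg P d⁻¹ * piece deg P e⁻¹ = piece deg P (d⁻¹ * e⁻¹)) ↔
    ∃ t : Kind, ∀ d ∈ s, IsKind deg P d t := by
  constructor
  · intro h
    have hpow : ∀ d ∈ s, ∀ n : ℕ, piece deg P (d ^ (n + 1)) = piece deg P d ^ (n + 1) ∧
        piece deg P (d⁻¹ ^ (n + 1)) = piece deg P d⁻¹ ^ (n + 1) := by
      intro d hd n
      induction n with
      | zero => simp
      | succ n ih =>
        have := h _ (hs d hd n) d hd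
        constructor
        · rw [pow_succ, ← this.1, ih.1, ← pow_succ]
        · rw [pow_succ, inv_pow, ← this.2, ← inv_pow, ih.2, ← pow_succ]
    -- A property insensitive to powers is constant on `s`, by passing through a common root.
    have htrans : ∀ p : D → Prop, (∀ d ∈ s, ∀ n : ℕ, p (d ^ (n + 1)) ↔ p d) →
        ∀ d ∈ s, p d → ∀ e ∈ s, p e := by
      intro p hp d hd hpd e he
      obtain ⟨f, hf, m, n, rfl, rfl⟩ := hdiv d hd e he
      exact (hp f hf n).2 ((hp f hf m).1 hpd)
    have hpr : ∀ d ∈ s, ∀ n : ℕ,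
        (Principal (piece deg P (d ^ (n + 1))) ↔ Principal (piece deg P d)) := fun d hd n =>
      principal_pow_iff hP fun k _ => (hpow d hd k).1
    have hpr' : ∀ d ∈ s, ∀ n : ℕ,
        (Principal (piece deg P (d ^ (n + 1))⁻¹) ↔ Principal (piece deg P d⁻¹)) :=
      fun d hd n => by
        rw [← inv_pow]
        exact principal_pow_iff hP fun k _ => (hpow d hd k).2
    obtain ⟨d₀, hd₀⟩ := hne
    by_cases hu : HasUnit deg P d₀
    · exact ⟨.a, htrans _ (fun d hd n => hasUnit_pow_iff (hpow d hd n).1) d₀ hd₀ hu⟩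
    replace hu := htrans (fun d => ¬ HasUnit deg P d)
      (fun d hd n => not_congr (hasUnit_pow_iff (hpow d hd n).1)) d₀ hd₀ hu
    by_cases hp : Principal (piece deg P d₀)
    · replace hp := htrans (fun d => Principal (piece deg P d)) hpr d₀ hd₀ hp
      have hb : ∀ d ∈ s, ∀ n : ℕ,
          leftStab deg (piece deg P d) ⊂ rightStab deg (piece deg P d) →
          leftStab deg (piece deg P (d ^ (n + 1))) ⊂ rightStab deg (piece deg P (d ^ (n + 1))) := by
        intro d hd n hlt
        rw [(hpow d hd n).1, leftStab_pow (fun y hy => hy.2) (hp d hd) hlt.subset]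
        exact hlt.trans_subset (rightStab_subset_rightStab_pow _ _)
      have hc : ∀ d ∈ s, ∀ n : ℕ,
          rightStab deg (piece deg P d) ⊂ leftStab deg (piece deg P d) →
          rightStab deg (piece deg P (d ^ (n + 1))) ⊂ leftStab deg (piece deg P (d ^ (n + 1))) := by
        intro d hd n hlt
        rw [(hpow d hd n).1, rightStab_pow (fun y hy => hy.2) (hp d hd) hlt.subset]
        exact hlt.trans_subset (leftStab_subset_leftStab_pow _ _)
      have hd' : ∀ d ∈ s, ∀ n : ℕ,
          leftStab deg (piece deg P d) = rightStab deg (piece deg P d) →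
          leftStab deg (piece deg P (d ^ (n + 1))) = rightStab deg (piece deg P (d ^ (n + 1))) := by
        intro d hd n heq
        rw [(hpow d hd n).1, leftStab_pow (fun y hy => hy.2) (hp d hd) heq.subset,
          rightStab_pow (fun y hy => hy.2) (hp d hd) heq.symm.subset, heq]
      -- The three relations are exhaustive and mutually exclusive, so that powers preserve each of
      -- them implies that powers also reflect each.
      have tri : ∀ d, leftStab deg (piece deg P d) ⊂ rightStab deg (piece deg P d) ∨
          leftStab deg (piece deg P d) = rightStab deg (piece deg P d) ∨
          rightStab deg (piece deg P d) ⊂ leftStab deg (piece deg P d) := fun d => by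
        rcases leftStab_rightStab_total (deg := deg) (d := d) hP with hle | hle
        · exact hle.eq_or_ssubset.elim (fun h => .inr (.inl h)) .inl
        · exact hle.eq_or_ssubset.elim (fun h => .inr (.inl h.symm)) fun h => .inr (.inr h)
      rcases tri d₀ with h0 | h0 | h0
      · refine ⟨.b, fun d hd => ⟨hp d hd, htrans
          (fun d => leftStab deg (piece deg P d) ⊂ rightStab deg (piece deg P d))
          (fun d hd n => ⟨fun h => ?_, hb d hd n⟩) d₀ hd₀ h0 d hd⟩⟩
        rcases tri d with h1 | h1 | h1
        · exact h1
        · exact absurd (hd' d hd n h1) h.ne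
        · exact absurd (hc d hd n h1) h.asymm
      · refine ⟨.d, fun d hd => ?_⟩
        have heq := htrans (fun d => leftStab deg (piece deg P d) = rightStab deg (piece deg P d))
          (fun d hd n => ⟨fun h => ?_, hd' d hd n⟩) d₀ hd₀ h0 d hd
        · exact ⟨hp d hd, fun hi => hu d hd
            (hasUnit_of_principal hP (hpow d hd 1).1 (hpow d hd 1).2 (hp d hd) hi heq), heq⟩
        · rcases tri d with h1 | h1 | h1
          · exact absurd h (hb d hd n h1).ne
          · exact h1
          · exact absurd h (hc d hd n h1).ne'
      · refine ⟨.c, fun d hd => ⟨hp d hd, htrans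
          (fun d => rightStab deg (piece deg P d) ⊂ leftStab deg (piece deg P d))
          (fun d hd n => ⟨fun h => ?_, hc d hd n⟩) d₀ hd₀ h0 d hd⟩⟩
        rcases tri d with h1 | h1 | h1
        · exact absurd (hb d hd n h1) h.asymm
        · exact absurd (hd' d hd n h1) h.ne'
        · exact h1
    · replace hp := htrans (fun d => ¬ Principal (piece deg P d))
        (fun d hd n => not_congr (hpr d hd n)) d₀ hd₀ hp
      by_cases hi : Principal (piece deg P d₀⁻¹)
      · exact ⟨.f, fun d hd => ⟨hp d hd,
          htrans (fun d => Principal (piece deg P d⁻¹)) hpr' d₀ hd₀ hi d hd⟩⟩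
      · replace hi := htrans (fun d => ¬ Principal (piece deg P d⁻¹))
          (fun d hd n => not_congr (hpr' d hd n)) d₀ hd₀ hi
        refine ⟨.g, fun d hd => ⟨(star_eq_iff hP).2 fun h => hi d hd h.2, ?_⟩⟩
        rintro n ⟨c, hc⟩
        -- The piece of degree `d ^ (n + 1)` is its own star closure, so a principal closure would
        -- make that piece principal.
        rw [← (hpow d hd n).1, (star_eq_iff hP).2 fun h => hi _ (hs d hd n) h.2] at hc
        refine hp _ (hs d hd n) ?_
        rw [hc]
        exact (principal_leftStab _).image_mul_right _
  · rintro ⟨t, ht⟩ d hd e he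
    obtain ⟨f, hf, m, n, rfl, rfl⟩ := hdiv d hd e he
    have hk := (ht f hf).piece_pow hP
    constructor
    · rw [(hk m).1, (hk n).1, ← pow_add, ← pow_add]
      exact ((hk (m + 1 + n)).1.trans (by rw [← add_assoc])).symm
    · rw [← inv_pow, ← inv_pow, (hk m).2, (hk n).2, ← pow_add, ← pow_add]
      exact ((hk (m + 1 + n)).2.trans (by rw [← add_assoc])).symm

end Total

end TotalCone

/-! ### The kinds expressed through generators. -/

namespace TotalCone

variable {Γ D : Type*} [Group Γ] [CommGroup D] {deg : Γ →* D} {P : Submonoid Γ} {d : D}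

theorem hasUnit_iff : HasUnit deg P d ↔ ∃ u, deg u = d ∧ piece deg P d = piece deg P 1 * {u} ∧
    piece deg P d = {u} * piece deg P 1 ∧ piece deg P d⁻¹ = piece deg P 1 * {u⁻¹} := by
  have h1 : (1 : Γ) ∈ piece deg P 1 := ⟨P.one_mem, map_one _⟩
  constructor
  · rintro ⟨u, hu, hu', rfl⟩
    have h2 : u ∈ piece deg P (deg u) := ⟨hu, rfl⟩
    have h3 : u⁻¹ ∈ piece deg P (deg u)⁻¹ := ⟨hu', map_inv _ _⟩
    refine ⟨u, rfl, ?_, ?_, ?_⟩ <;> ext x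
    · rw [mem_mul_singleton_iff]
      exact ⟨fun h => by simpa using mul_mem_piece h h3, fun h => by simpa using mul_mem_piece h h2⟩
    · rw [mem_singleton_mul_iff]
      exact ⟨fun h => by simpa using mul_mem_piece h3 h, fun h => by simpa using mul_mem_piece h2 h⟩
    · rw [mem_mul_singleton_iff, inv_inv]
      exact ⟨fun h => by simpa using mul_mem_piece h h2, fun h => by simpa using mul_mem_piece h h3⟩
  · rintro ⟨u, hu, h2, -, h3⟩
    refine ⟨u, ?_, ?_, hu⟩
    · exact (show u ∈ piece deg P d by rw [h2, mem_mul_singleton_iff, mul_inv_cancel]; exact h1).1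
    · exact (show u⁻¹ ∈ piece deg P d⁻¹ by
        rw [h3, mem_mul_singleton_iff, mul_inv_cancel]; exact h1).1

theorem singleton_mul_subset_iff {S T : Set Γ} {u : Γ} : {u} * S ⊆ {u} * T ↔ S ⊆ T := by
  rw [Set.singleton_mul, Set.singleton_mul, Set.image_subset_image_iff (mul_right_injective u)]

theorem singleton_mul_ssubset_iff {S T : Set Γ} {u : Γ} : {u} * S ⊂ {u} * T ↔ S ⊂ T := by
  rw [ssubset_iff_subset_not_subset, ssubset_iff_subset_not_subset, singleton_mul_subset_iff,
    singleton_mul_subset_iff]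

theorem singleton_mul_eq_iff {S T : Set Γ} {u : Γ} : {u} * S = {u} * T ↔ S = T := by
  rw [Set.Subset.antisymm_iff, Set.Subset.antisymm_iff, singleton_mul_subset_iff,
    singleton_mul_subset_iff]

theorem eq_leftStab_mul_singleton_iff {S : Set Γ} (hd : ∀ y ∈ S, deg y = d) {u : Γ} :
    S = leftStab deg S * {u} ↔ u ∈ S ∧ ∀ y ∈ S, ∀ z ∈ S, y * u⁻¹ * z ∈ S := by
  refine ⟨fun hS => ⟨?_, fun y hy z hz => ?_⟩, fun h => eq_leftStab_mul_singleton hd h.1 h.2⟩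
  · rw [hS, mem_mul_singleton_iff, mul_inv_cancel]
    exact one_mem_leftStab S
  · rw [hS, mem_mul_singleton_iff] at hy
    exact hy.2 z hz

/-- A relation between a principal set `W u` and `u W` amounts to a relation between its left and
right stabilizers. -/
theorem exists_eq_mul_singleton_iff {S : Set Γ} (hd : ∀ y ∈ S, deg y = d)
    (R : Set Γ → Set Γ → Prop) (hR : ∀ (u : Γ) T T', R ({u} * T) ({u} * T') ↔ R T T') :
    (∃ u, deg u = d ∧ S = leftStab deg S * {u} ∧ R ({u} * leftStab deg S) S) ↔
      Principal S ∧ R (leftStab deg S) (rightStab deg S) := by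
  have key : ∀ u, S = leftStab deg S * {u} →
      (R ({u} * leftStab deg S) S ↔ R (leftStab deg S) (rightStab deg S)) := fun u hu => by
    obtain ⟨huS, h⟩ := (eq_leftStab_mul_singleton_iff hd).1 hu
    exact (iff_of_eq (congrArg (R _) (eq_singleton_mul_rightStab hd huS h))).trans (hR _ _ _)
  constructor
  · rintro ⟨u, -, hS, h⟩
    exact ⟨⟨u, (eq_leftStab_mul_singleton_iff hd).1 hS⟩, (key u hS).1 h⟩
  · rintro ⟨⟨u, hu⟩, h⟩
    have hS := (eq_leftStab_mul_singleton_iff hd).2 hu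
    exact ⟨u, hd u hu.1, hS, (key u hS).2 h⟩

theorem isKind_b_iff : IsKind deg P d .b ↔ ∃ u, deg u = d ∧
    piece deg P d = leftStab deg (piece deg P d) * {u} ∧
    {u} * leftStab deg (piece deg P d) ⊂ piece deg P d :=
  (exists_eq_mul_singleton_iff (fun _ hy => hy.2) (fun T T' => T ⊂ T')
    fun _ _ _ => singleton_mul_ssubset_iff).symm

theorem isKind_c_iff : IsKind deg P d .c ↔ ∃ u, deg u = d ∧
    piece deg P d = leftStab deg (piece deg P d) * {u} ∧
    piece deg P d ⊂ {u} * leftStab deg (piece deg P d) :=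
  (exists_eq_mul_singleton_iff (fun _ hy => hy.2) (fun T T' => T' ⊂ T)
    fun _ _ _ => singleton_mul_ssubset_iff).symm

/-- With equal stabilizers and no unit, `P_{d⁻¹}` is `J u⁻¹`, so its failure to be principal is that
of the radical `J`, which amounts to `J J = J`. -/
theorem isKind_d_iff (hP : ∀ x, x ∈ P ∨ x⁻¹ ∈ P) : IsKind deg P d .d ↔ ∃ u, deg u = d ∧
    piece deg P d = leftStab deg (piece deg P d) * {u} ∧
    piece deg P d = {u} * leftStab deg (piece deg P d) ∧
    piece deg P d⁻¹ = radical deg (leftStab deg (piece deg P d)) * {u⁻¹} ∧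
    radical deg (leftStab deg (piece deg P d)) * radical deg (leftStab deg (piece deg P d)) =
      radical deg (leftStab deg (piece deg P d)) := by
  constructor
  · rintro ⟨hpr, hn, hW⟩
    obtain ⟨u, hud, hl, hr⟩ := (exists_eq_mul_singleton_iff (fun _ hy => hy.2)
      (fun T T' => T' = T) fun _ _ _ => singleton_mul_eq_iff).2 ⟨hpr, hW.symm⟩
    have hu : ¬ HasUnit deg P d := fun h => hn h.inv.principal
    have hi : piece deg P d⁻¹ = radical deg (leftStab deg (piece deg P d)) * {u⁻¹} := by
      ext x
      rw [mem_mul_singleton_iff, inv_inv]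
      constructor
      · refine fun hx => ⟨by simp [hx.2, hud], fun h => ?_⟩
        have : x⁻¹ ∈ piece deg P d := by
          rw [hr, mem_singleton_mul_iff, ← mul_inv_rev]
          exact h
        exact inv_notMem_of_not_hasUnit (by rwa [hasUnit_inv_iff]) hx this.1
      · intro hx
        have hx1 : deg x = d⁻¹ := by
          rw [← hud]; exact eq_inv_of_mul_eq_one_left (by rw [← map_mul]; exact hx.1)
        rw [← inv_inv x]
        refine inv_mem_piece hP (by simp [hx1]) fun h => hx.2 ?_
        rw [hr, mem_singleton_mul_iff, ← mul_inv_rev] at h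
        exact h
    refine ⟨u, hud, hl, hr, hi, Set.Subset.antisymm ?_ fun j hj => ?_⟩
    · rintro _ ⟨x, hx, y, hy, rfl⟩
      have := leftStab_radical (deg := deg) (piece deg P d)
      have hxW : x ∈ leftStab deg (piece deg P d) :=
        (leftStab_total hP hx.1).resolve_right hx.2
      rw [← this] at hxW
      exact hxW.2 y hy
    · have hj' : j * u⁻¹ ∈ piece deg P d⁻¹ := by
        rw [hi, mem_mul_singleton_iff]
        simpa using hj
      have : ∃ y ∈ piece deg P d⁻¹, ∃ z ∈ piece deg P d⁻¹,
          y * (j * u⁻¹)⁻¹ * z ∉ piece deg P d⁻¹ := by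
        by_contra! H
        exact hn ⟨_, hj', H⟩
      obtain ⟨y, hy, z, hz, hyz⟩ := this
      rw [hi, mem_mul_singleton_iff, inv_inv] at hy hz hyz
      have h1 : (y * (j * u⁻¹)⁻¹ * z * u)⁻¹ ∈ leftStab deg (piece deg P d) := by
        by_contra hn
        refine hyz ⟨?_, hn⟩
        have h1 := hy.1
        have h2 := hz.1
        have h3 := hj.1
        simp only [map_mul, map_inv] at h1 h2 h3 ⊢
        rw [h3, one_mul, inv_inv, h1, one_mul, h2]
      -- This element times `y u`, which is also in the radical, equals `j`.
      have h2 : z * u * (y * (j * u⁻¹)⁻¹ * z * u)⁻¹ ∈ radical deg (leftStab deg (piece deg P d)) := by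
        refine ⟨by rw [map_mul, hz.1, h1.1, one_mul], fun h => hz.2 ?_⟩
        have := mul_mem_leftStab h1 h
        rwa [mul_inv_rev (z * u), mul_inv_cancel_left] at this
      exact ⟨_, h2, _, hy, by group⟩
  · rintro ⟨u, hud, hl, hr, hi, hJ⟩
    have := (exists_eq_mul_singleton_iff (fun _ hy => hy.2)
      (fun T T' => T' = T) fun _ _ _ => singleton_mul_eq_iff).1 ⟨u, hud, hl, hr⟩
    refine ⟨this.1, ?_, this.2.symm⟩
    rw [hi, principal_mul_singleton_iff]
    rintro ⟨j, hj, h⟩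
    obtain ⟨x, hx, y, hy, rfl⟩ := hJ.symm.subset hj
    have h1 := h y hy x hx
    -- A generator that factors as `x y` inside the radical would force `1` into the radical.
    have h2 : y * (x * y)⁻¹ * x = 1 := by group
    rw [h2] at h1
    exact h1.2 (by simpa using one_mem_leftStab (piece deg P d))

end TotalCone

/-! ### Dictionary between additive subgroups of `K` and homogeneous sets. -/

namespace GradedExt

variable {K : Type*} [DivisionRing K]

theorem mem_rightMul_iff {I : AddSubgroup K} {c x : K} (hc : c ≠ 0) :
    x ∈ rightMul I c ↔ x * c⁻¹ ∈ I := by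
  constructor
  · rintro ⟨y, hy, rfl⟩
    simpa [hc] using hy
  · exact fun h => ⟨_, h, by simp [hc]⟩

theorem mem_leftMul_iff {I : AddSubgroup K} {c x : K} (hc : c ≠ 0) :
    x ∈ leftMul c I ↔ c⁻¹ * x ∈ I := by
  constructor
  · rintro ⟨y, hy, rfl⟩
    simpa [hc] using hy
  · exact fun h => ⟨_, h, by simp [hc]⟩

theorem apply_mem_conj_iff {I : AddSubgroup K} {τ : RingAut K} {x : K} :
    τ x ∈ conj I τ ↔ x ∈ I :=
  AddSubgroup.mem_map_iff_mem (f := (RingEquiv.toRingHom τ).toAddMonoidHom) τ.injective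

/-- A total valuation ring is local. For a non-unit `t`, one of `t (1 + t)⁻¹ = 1 - (1 + t)⁻¹` and
`(1 + t) t⁻¹ = t⁻¹ + 1` is in `W`; the second would give `t⁻¹ ∈ W`, so `1 + t` is a unit. -/
theorem mem_jacobsonRadical_iff {W : Subring K} (hW : IsTotalValuationRing W) {x : K}
    (hx : x ≠ 0) : x ∈ jacobsonRadical W ↔ x⁻¹ ∉ W := by
  have key : ∀ w : W, w ∈ Ring.jacobson W ↔ ∀ y, ∃ z, z * y * w + z - 1 = 0 := fun w => by
    rw [← Ideal.jacobson_bot, Ideal.mem_jacobson_iff]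
    simp
  constructor
  · rintro ⟨w, hw, rfl⟩ hwi
    obtain ⟨z, hz⟩ := (key w).1 hw (-⟨_, hwi⟩)
    have := congrArg (Subtype.val) hz
    change (z : K) * -((w : K)⁻¹) * w + z - 1 = 0 at this
    rw [mul_assoc, neg_mul, inv_mul_cancel₀ (show (w : K) ≠ 0 from hx)] at this
    simp at this
  · intro hxi
    have hxW : x ∈ W := (hW x hx).resolve_right hxi
    refine ⟨⟨x, hxW⟩, (key _).2 fun y => ?_, rfl⟩
    have hyx : ∀ t : K, t ≠ 0 → t = y * x → t⁻¹ ∉ W := fun t ht h hti => hxi <| by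
      have hy : (y : K) ≠ 0 := fun h0 => ht (by rw [h, h0, zero_mul])
      have := W.mul_mem hti y.2
      rwa [h, mul_inv_rev, mul_assoc, inv_mul_cancel₀ hy, mul_one] at this
    have hu : (1 + y * x : K) ≠ 0 := fun h0 => by
      have h1 : (y * x : K) = -1 := (neg_eq_of_add_eq_zero_right h0).symm
      refine hyx (y * x) (by rw [h1]; simp) rfl ?_
      rw [h1]
      simp
    suffices h : (1 + y * x : K)⁻¹ ∈ W by
      refine ⟨⟨_, h⟩, Subtype.ext ?_⟩
      change (1 + y * x : K)⁻¹ * y * x + (1 + y * x : K)⁻¹ - 1 = 0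
      rw [mul_assoc, ← mul_add_one, add_comm (y * x : K), inv_mul_cancel₀ hu, sub_self]
    by_cases ht : (y * x : K) = 0
    · simp [ht]
    have hti := hyx _ ht rfl
    set t : K := y * x
    by_contra hui
    rcases hW (t * (1 + t)⁻¹) (mul_ne_zero ht (inv_ne_zero hu)) with h | h
    · have h1 : t * (1 + t)⁻¹ = 1 - (1 + t)⁻¹ := by
        rw [eq_sub_iff_add_eq, ← add_one_mul, add_comm t, mul_inv_cancel₀ hu]
      rw [h1] at h
      exact hui (by simpa using W.sub_mem W.one_mem h)
    · rw [mul_inv_rev, inv_inv, add_mul, one_mul, mul_inv_cancel₀ ht] at h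
      exact hti (by simpa using W.sub_mem h W.one_mem)

variable (σ : Multiplicative ℚ →* RingAut K)

/-- The action of `ℚ` on the units of `K`. -/
def unitsAut : Multiplicative ℚ →* MulAut Kˣ where
  toFun g := Units.mapEquiv (RingEquiv.toMulEquiv (σ g))
  map_one' := by ext; simp
  map_mul' g h := by ext; simp

/-- The group of non-zero homogeneous elements `a X^g` of `K[ℚ, σ]`. -/
abbrev HomogeneousUnits : Type _ := Kˣ ⋊[unitsAut σ] Multiplicative ℚ

/-- The degree of a homogeneous element. -/
abbrev degree : HomogeneousUnits σ →* Multiplicative ℚ := SemidirectProduct.rightHom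

/-- The homogeneous elements `a X^g` with `0 ≠ a ∈ I`. -/
def homogeneous (g : ℚ) (I : AddSubgroup K) : Set (HomogeneousUnits σ) :=
  {x | x.right = Multiplicative.ofAdd g ∧ (x.left : K) ∈ I}

variable {σ} {g h : ℚ} {I J : AddSubgroup K}

theorem homogeneous_subset_iff : homogeneous σ g I ⊆ homogeneous σ g J ↔ I ≤ J := by
  refine ⟨fun h x hx => ?_, fun h x hx => ⟨hx.1, h hx.2⟩⟩
  rcases eq_or_ne x 0 with rfl | h0
  · exact J.zero_mem
  · exact (@h ⟨Units.mk0 x h0, Multiplicative.ofAdd g⟩ ⟨rfl, hx⟩).2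

theorem homogeneous_inj : homogeneous σ g I = homogeneous σ g J ↔ I = J := by
  rw [Set.Subset.antisymm_iff, homogeneous_subset_iff, homogeneous_subset_iff, le_antisymm_iff]

theorem homogeneous_ssubset_iff : homogeneous σ g I ⊂ homogeneous σ g J ↔ I < J := by
  rw [ssubset_iff_subset_not_subset, homogeneous_subset_iff, homogeneous_subset_iff,
    lt_iff_le_not_ge]

theorem leftStab_homogeneous : TotalCone.leftStab (degree σ) (homogeneous σ g I) =
    homogeneous σ 0 (leftOrder I).toAddSubgroup := by
  ext x
  refine and_congr_right fun hx => ?_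
  change x.right = 1 at hx
  constructor
  · intro h y hy
    rcases eq_or_ne y 0 with rfl | h0
    · simp
    · have := (h ⟨Units.mk0 y h0, Multiplicative.ofAdd g⟩ ⟨rfl, hy⟩).2
      simpa [hx] using this
  · intro h y hy
    refine ⟨by simp [hx, hy.1], ?_⟩
    simpa [hx] using h _ hy.2

theorem homogeneous_rightMul (u : HomogeneousUnits σ) (hu : u.right = Multiplicative.ofAdd g) :
    homogeneous σ g (rightMul I u.left) = homogeneous σ 0 I * {u} := by
  ext x
  rw [TotalCone.mem_mul_singleton_iff]
  change _ ∧ _ ↔ x.right * u.right⁻¹ = 1 ∧ _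
  rw [mul_inv_eq_one, hu, mem_rightMul_iff u.left.ne_zero]
  refine and_congr_right fun hx => ?_
  have : (x * u⁻¹).left = x.left * u.left⁻¹ := by
    simp [hx, hu]
  rw [this]
  simp

theorem homogeneous_leftMul_conj (u : HomogeneousUnits σ)
    (hu : u.right = Multiplicative.ofAdd g) :
    homogeneous σ g (leftMul u.left (conj I (aut σ g))) = {u} * homogeneous σ 0 I := by
  ext x
  rw [TotalCone.mem_singleton_mul_iff]
  change _ ∧ _ ↔ u.right⁻¹ * x.right = 1 ∧ _
  rw [inv_mul_eq_one, hu, mem_leftMul_iff u.left.ne_zero, eq_comm]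
  refine and_congr_right fun hx => ?_
  have : aut σ g ((u⁻¹ * x).left : K) = (u.left : K)⁻¹ * x.left := by
    simp [hu, unitsAut, aut]
  rw [← this, apply_mem_conj_iff]

theorem mul_mem_mul_conj {a b : K} (ha : a ∈ I) (hb : b ∈ J) (τ : RingAut K) :
    a * τ b ∈ I * conj J τ :=
  AddSubmonoid.mul_mem_mul (M := I.toAddSubmonoid) (N := (conj J τ).toAddSubmonoid) ha
    (apply_mem_conj_iff.2 hb)

/-- Of two non-zero products, one is a left `V`-multiple of the other, so their sum is a single
product with the same right factor. -/
theorem exists_of_mem_mul_conj {V : Subring K} (hV : IsTotalValuationRing V)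
    (hI : ∀ v ∈ V, ∀ a ∈ I, v * a ∈ I) {τ : RingAut K} {x : K} (hx : x ∈ I * conj J τ) :
    ∃ a ∈ I, ∃ b ∈ J, a * τ b = x := by
  refine AddSubmonoid.mul_induction_on (M := I.toAddSubmonoid) (N := (conj J τ).toAddSubmonoid)
    (C := fun x => ∃ a ∈ I, ∃ b ∈ J, a * τ b = x) hx ?_ ?_
  · rintro a ha _ ⟨b, hb, rfl⟩
    exact ⟨a, ha, b, hb, rfl⟩
  · rintro x y ⟨a, ha, b, hb, rfl⟩ ⟨c, hc, d, hd, rfl⟩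
    rcases eq_or_ne (c * τ d) 0 with h0 | h0
    · exact ⟨a, ha, b, hb, by rw [h0, add_zero]⟩
    rcases eq_or_ne (a * τ b) 0 with h0' | h0'
    · exact ⟨c, hc, d, hd, by rw [h0', zero_add]⟩
    rcases hV ((a * τ b) * (c * τ d)⁻¹) (mul_ne_zero h0' (inv_ne_zero h0)) with h | h
    · refine ⟨a * τ b * (c * τ d)⁻¹ * c + c, I.add_mem (hI _ h _ hc) hc, d, hd, ?_⟩
      rw [add_mul, mul_assoc _ c, inv_mul_cancel_right₀ h0]
    · rw [mul_inv_rev, inv_inv] at h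
      refine ⟨a + c * τ d * (a * τ b)⁻¹ * a, I.add_mem ha (hI _ h _ ha), b, hb, ?_⟩
      rw [add_mul, mul_assoc _ a, inv_mul_cancel_right₀ h0']

theorem homogeneous_mul_conj {V : Subring K} (hV : IsTotalValuationRing V)
    (hI : ∀ v ∈ V, ∀ a ∈ I, v * a ∈ I) (J : AddSubgroup K) :
    homogeneous σ (g + h) (I * conj J (aut σ g)) = homogeneous σ g I * homogeneous σ h J := by
  ext x
  constructor
  · rintro ⟨hx, hx'⟩
    obtain ⟨a, ha, b, hb, hab⟩ := exists_of_mem_mul_conj hV hI hx'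
    have ha0 : a ≠ 0 := fun h0 => x.left.ne_zero (by rw [← hab, h0, zero_mul])
    have hb0 : b ≠ 0 := fun h0 => x.left.ne_zero (by rw [← hab, h0, map_zero, mul_zero])
    refine ⟨⟨Units.mk0 a ha0, Multiplicative.ofAdd g⟩, ⟨rfl, ha⟩,
      ⟨Units.mk0 b hb0, Multiplicative.ofAdd h⟩, ⟨rfl, hb⟩, SemidirectProduct.ext (Units.ext ?_) ?_⟩
    · exact hab
    · exact hx.symm
  · rintro ⟨y, hy, z, hz, rfl⟩
    refine ⟨by simp [hy.1, hz.1], ?_⟩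
    have : ((y * z).left : K) = y.left * aut σ g z.left := by
      simp [hy.1, unitsAut, aut]
    change ((y * z).left : K) ∈ _
    rw [this]
    exact mul_mem_mul_conj hy.2 hz.2 _

theorem homogeneous_jacobsonRadical {W : Subring K} (hW : IsTotalValuationRing W) :
    homogeneous σ 0 (jacobsonRadical W) =
      TotalCone.radical (degree σ) (homogeneous σ 0 W.toAddSubgroup) := by
  ext x
  refine and_congr_right fun hx => ?_
  change x.right = 1 at hx
  rw [mem_jacobsonRadical_iff hW x.left.ne_zero]
  refine not_congr ?_
  have : ((x⁻¹).left : K) = (x.left : K)⁻¹ := by simp [hx]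
  change _ ↔ (x⁻¹).right = 1 ∧ ((x⁻¹).left : K) ∈ W
  rw [this]
  simp [hx]

theorem homogeneous_starClosure : homogeneous σ g (starClosure I) =
    TotalCone.star (degree σ) (Multiplicative.ofAdd g) (homogeneous σ g I) := by
  ext x
  refine and_congr_right fun hx => ?_
  have key : ∀ u : HomogeneousUnits σ, u.right = Multiplicative.ofAdd g →
      homogeneous σ g (leftPrincipal (leftOrder I) u.left) =
        TotalCone.leftStab (degree σ) (homogeneous σ g I) * {u} := fun u hu => by
    rw [leftStab_homogeneous, leftPrincipal, homogeneous_rightMul u hu]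
  constructor
  · intro h u hu hsub
    have h1 : I ≤ leftPrincipal (leftOrder I) u.left := by
      rw [← homogeneous_subset_iff (σ := σ) (g := g), key u hu]
      intro y hy
      exact TotalCone.mem_mul_singleton_iff.2 (hsub y hy)
    have h2 : x ∈ homogeneous σ g (leftPrincipal (leftOrder I) u.left) :=
      ⟨hx, AddSubgroup.mem_sInf.1 h _ ⟨_, u.left.ne_zero, rfl, h1⟩⟩
    rw [key u hu] at h2
    exact TotalCone.mem_mul_singleton_iff.1 h2
  · intro h
    refine AddSubgroup.mem_sInf.2 ?_
    rintro _ ⟨c, hc, rfl, hI⟩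
    have hk := key ⟨Units.mk0 c hc, Multiplicative.ofAdd g⟩ rfl
    have := h ⟨Units.mk0 c hc, Multiplicative.ofAdd g⟩ rfl fun y hy => by
      rw [← TotalCone.mem_mul_singleton_iff, ← hk]
      exact homogeneous_subset_iff.2 hI hy
    rw [← TotalCone.mem_mul_singleton_iff, ← hk] at this
    exact this.2

/-- Needed because type (g) also allows `W c` with `c = 0`, which has no counterpart in the group of
homogeneous units. For `I = 0` the left order is all of `K`. -/
theorem starClosure_ne_bot (I : AddSubgroup K) : starClosure I ≠ ⊥ := by
  intro h
  have hI : I = ⊥ := le_bot_iff.1 (h ▸ le_sInf fun L hL => by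
    obtain ⟨c, -, -, hIL⟩ := hL
    exact hIL)
  have : (1 : K) ∈ starClosure I := by
    refine AddSubgroup.mem_sInf.2 ?_
    rintro _ ⟨c, hc, rfl, -⟩
    rw [leftPrincipal, mem_rightMul_iff hc]
    intro x hx
    rw [hI, AddSubgroup.mem_bot] at hx
    rw [hx, mul_zero]
    exact I.zero_mem
  rw [h] at this
  exact one_ne_zero (AddSubgroup.mem_bot.1 this)

end GradedExt

/-! ### The cone of a graded extension and translation of the types. -/

namespace GradedExt

open TotalCone

variable {K : Type*} [DivisionRing K] {V : Subring K} {σ : Multiplicative ℚ →* RingAut K}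
  {A : Subring (SkewGroupRing σ)} {G : AddSubgroup ℚ}

theorem coeff_monomial_of_ne {g h : ℚ} (hgh : g ≠ h) (a : K) :
    coeff (monomial σ g a) h = 0 :=
  Finsupp.single_eq_of_ne fun he => hgh (Multiplicative.ofAdd.injective he).symm

theorem monomial_mem_skewGroupSubring {g : ℚ} (hg : g ∈ G) (a : K) :
    monomial σ g a ∈ skewGroupSubring σ G := by
  intro h hh
  by_contra hn
  exact hh (coeff_monomial_of_ne (fun he : g = h => hn (he ▸ hg)) a)

theorem aut_aut_neg (g : ℚ) (a : K) : aut σ g (aut σ (-g) a) = a := by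
  simp [aut]

theorem monomial_mul_monomial_inv (g : ℚ) {a : K} (ha : a ≠ 0) :
    monomial σ g a * monomial σ (-g) (aut σ (-g) a⁻¹) = 1 := by
  rw [monomial_mul_monomial, aut_aut_neg, mul_inv_cancel₀ ha, add_neg_cancel, one_eq_monomial]

theorem IsGradedExtension.mem_or_inv_mem (hA : IsGradedExtension σ V G A) {g : ℚ} (hg : g ∈ G)
    {a : K} (ha : a ≠ 0) :
    monomial σ g a ∈ A ∨ monomial σ (-g) (aut σ (-g) a⁻¹) ∈ A := by
  refine (hA.total g hg a ha).imp_right ?_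
  rintro ⟨y, hy, -, hya⟩
  have := left_inv_eq_right_inv hya (monomial_mul_monomial_inv g ha)
  exact this ▸ hy

theorem component_cyclicPiece {r g : ℚ} (hg : g ∈ AddSubgroup.zmultiples r) :
    component σ (cyclicPiece σ A r) g = component σ A g := by
  ext a
  exact and_iff_left (monomial_mem_skewGroupSubring hg a)

theorem isGradedExtension_cyclicPiece (hA : IsGradedExtension σ V ⊤ A) (r : ℚ) :
    IsGradedExtension σ V (AddSubgroup.zmultiples r) (cyclicPiece σ A r) where
  le := inf_le_right
  graded f hf g := by
    by_cases h : coeff f g = 0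
    · rw [h, monomial_zero]
      exact Subring.zero_mem _
    · exact ⟨hA.graded f hf.1 g, monomial_mem_skewGroupSubring (hf.2 g h) _⟩
  total g hg a ha := by
    refine (hA.mem_or_inv_mem trivial ha).imp
      (fun h => ⟨h, monomial_mem_skewGroupSubring hg a⟩) fun h =>
      ⟨_, ⟨h, monomial_mem_skewGroupSubring (neg_mem hg) _⟩, monomial_mul_monomial_inv g ha, ?_⟩
    rw [monomial_mul_monomial, ← map_mul, inv_mul_cancel₀ ha, map_one, neg_add_cancel,
      one_eq_monomial]
  component_zero := by
    rw [component_cyclicPiece (zero_mem _), hA.component_zero]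

variable (A) in
/-- The non-zero homogeneous elements of `A`. -/
def cone : Submonoid (HomogeneousUnits σ) where
  carrier := {x | monomial σ (Multiplicative.toAdd x.right) (x.left : K) ∈ A}
  one_mem' := by
    change monomial σ 0 1 ∈ A
    exact one_eq_monomial σ ▸ A.one_mem
  mul_mem' {x y} hx hy := by
    have := A.mul_mem hx hy
    rwa [monomial_mul_monomial] at this

theorem piece_cone (g : ℚ) :
    piece (degree σ) (cone A) (Multiplicative.ofAdd g) = homogeneous σ g (component σ A g) := by
  ext x
  refine and_comm.trans (and_congr_right fun hx => ?_)
  change monomial σ (Multiplicative.toAdd x.right) (x.left : K) ∈ A ↔ monomial σ g x.left ∈ A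
  have hx' : x.right = Multiplicative.ofAdd g := hx
  rw [hx', toAdd_ofAdd]

theorem piece_cone_inv (g : ℚ) : piece (degree σ) (cone A) (Multiplicative.ofAdd g)⁻¹ =
    homogeneous σ (-g) (component σ A (-g)) := by
  rw [← ofAdd_neg, piece_cone]

theorem IsGradedExtension.cone_total (hA : IsGradedExtension σ V ⊤ A) (x : HomogeneousUnits σ) :
    x ∈ cone A ∨ x⁻¹ ∈ cone A := by
  have := hA.mem_or_inv_mem (g := Multiplicative.toAdd x.right) trivial x.left.ne_zero
  rwa [← Units.val_inv_eq_inv_val] at this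

theorem IsGradedExtension.mul_mem_component (hA : IsGradedExtension σ V G A) (g : ℚ) {v a : K}
    (hv : v ∈ V) (ha : a ∈ component σ A g) : v * a ∈ component σ A g := by
  have h1 : v ∈ component σ A 0 := hA.component_zero ▸ hv
  have := A.mul_mem h1 ha
  rw [monomial_mul_monomial, zero_add] at this
  have h2 : aut σ 0 a = a := by simp [aut]
  rwa [h2] at this

theorem IsGradedExtension.le_leftOrder (hA : IsGradedExtension σ V G A) (g : ℚ) :
    V ≤ leftOrder (component σ A g) :=
  fun _ hv _ ha => hA.mul_mem_component g hv ha

theorem IsTotalValuationRing.mono {W : Subring K} (hV : IsTotalValuationRing V) (h : V ≤ W) :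
    IsTotalValuationRing W :=
  fun k hk => (hV k hk).imp (@h k) (@h k⁻¹)

/-- Stability under `V` is carried along because collapsing sums of products at the next step
requires it. -/
theorem homogeneous_powerProduct (hV : IsTotalValuationRing V) (hA : IsGradedExtension σ V G A)
    (g : ℚ) (n : ℕ) :
    (∀ v ∈ V, ∀ a ∈ powerProduct σ V A g (n + 1), v * a ∈ powerProduct σ V A g (n + 1)) ∧
    homogeneous σ ((n + 1 : ℕ) * g) (powerProduct σ V A g (n + 1)) =
      homogeneous σ g (component σ A g) ^ (n + 1) := by
  induction n with
  | zero => exact ⟨fun v hv a ha => hA.mul_mem_component g hv ha, by simp [powerProduct]⟩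
  | succ n ih =>
    constructor
    · intro v hv x hx
      obtain ⟨a, ha, b, hb, rfl⟩ := exists_of_mem_mul_conj hV ih.1 hx
      rw [← mul_assoc]
      exact mul_mem_mul_conj (ih.1 v hv a ha) hb _
    · rw [pow_succ, ← ih.2, ← homogeneous_mul_conj hV ih.1]
      have : (n + 1 + 1 : ℕ) * g = (n + 1 : ℕ) * g + g := by push_cast; ring
      rw [this]
      rfl

section Kinds

variable (hV : IsTotalValuationRing V) (hA : IsGradedExtension σ V ⊤ A) (r : ℚ)

theorem exists_homogeneousUnit_iff {p : K → Prop}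
    {q : HomogeneousUnits σ → Prop} (h : ∀ u : HomogeneousUnits σ,
      u.right = Multiplicative.ofAdd r → (p u.left ↔ q u)) :
    (∃ a : K, a ≠ 0 ∧ p a) ↔ ∃ u, degree σ u = Multiplicative.ofAdd r ∧ q u := by
  constructor
  · rintro ⟨a, ha, hp⟩
    exact ⟨⟨Units.mk0 a ha, Multiplicative.ofAdd r⟩, rfl, (h _ rfl).1 hp⟩
  · rintro ⟨u, hu, hq⟩
    exact ⟨u.left, u.left.ne_zero, (h u hu).2 hq⟩

theorem component_cyclicPiece_self :
    component σ (cyclicPiece σ A r) r = component σ A r :=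
  component_cyclicPiece (AddSubgroup.mem_zmultiples r)

theorem component_cyclicPiece_neg :
    component σ (cyclicPiece σ A r) (-r) = component σ A (-r) :=
  component_cyclicPiece (neg_mem (AddSubgroup.mem_zmultiples r))

theorem homogeneous_rightMul_inv {I : AddSubgroup K} {u : HomogeneousUnits σ}
    (hu : u.right = Multiplicative.ofAdd r) :
    homogeneous σ (-r) (rightMul I (aut σ (-r) (u.left : K)⁻¹)) = homogeneous σ 0 I * {u⁻¹} := by
  rw [← homogeneous_rightMul (g := -r) u⁻¹ (by simp [hu])]
  have : ((u⁻¹).left : K) = aut σ (-r) (u.left : K)⁻¹ := by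
    simp [hu, unitsAut, aut]
  rw [this]

include hA

theorem cyclicTypeA_iff : CyclicTypeA σ V r (cyclicPiece σ A r) ↔
    IsKind (degree σ) (cone A) (Multiplicative.ofAdd r) .a := by
  rw [CyclicTypeA, and_iff_right (isGradedExtension_cyclicPiece hA r)]
  refine (exists_homogeneousUnit_iff r fun u hu => ?_).trans hasUnit_iff.symm
  have h1 : piece (degree σ) (cone A) 1 = homogeneous σ 0 V.toAddSubgroup := by
    rw [← hA.component_zero, ← piece_cone]; rfl
  rw [component_cyclicPiece_self, component_cyclicPiece_neg, piece_cone, piece_cone_inv, h1,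
    ← homogeneous_rightMul u hu, ← homogeneous_leftMul_conj u hu,
    ← homogeneous_rightMul_inv r hu, homogeneous_inj, homogeneous_inj, homogeneous_inj]
  rfl

theorem cyclicTypeB_iff : CyclicTypeB σ V r (cyclicPiece σ A r) ↔
    IsKind (degree σ) (cone A) (Multiplicative.ofAdd r) .b := by
  rw [CyclicTypeB, and_iff_right (isGradedExtension_cyclicPiece hA r)]
  refine (exists_homogeneousUnit_iff r fun u hu => ?_).trans isKind_b_iff.symm
  rw [component_cyclicPiece_self, piece_cone, leftStab_homogeneous,
    ← homogeneous_rightMul u hu, ← homogeneous_leftMul_conj u hu, homogeneous_inj,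
    homogeneous_ssubset_iff]
  rfl

theorem cyclicTypeC_iff : CyclicTypeC σ V r (cyclicPiece σ A r) ↔
    IsKind (degree σ) (cone A) (Multiplicative.ofAdd r) .c := by
  rw [CyclicTypeC, and_iff_right (isGradedExtension_cyclicPiece hA r)]
  refine (exists_homogeneousUnit_iff r fun u hu => ?_).trans isKind_c_iff.symm
  rw [component_cyclicPiece_self, piece_cone, leftStab_homogeneous,
    ← homogeneous_rightMul u hu, ← homogeneous_leftMul_conj u hu, homogeneous_inj,
    homogeneous_ssubset_iff]
  rfl

include hV in
theorem cyclicTypeD_iff : CyclicTypeD σ V r (cyclicPiece σ A r) ↔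
    IsKind (degree σ) (cone A) (Multiplicative.ofAdd r) .d := by
  rw [CyclicTypeD, and_iff_right (isGradedExtension_cyclicPiece hA r)]
  refine (exists_homogeneousUnit_iff r fun u hu => ?_).trans (isKind_d_iff hA.cone_total).symm
  have hW := hV.mono (hA.le_leftOrder r)
  rw [component_cyclicPiece_self, component_cyclicPiece_neg, piece_cone, piece_cone_inv,
    leftStab_homogeneous, ← homogeneous_jacobsonRadical hW,
    ← homogeneous_rightMul u hu, ← homogeneous_leftMul_conj u hu,
    ← homogeneous_rightMul_inv r hu, homogeneous_inj, homogeneous_inj, homogeneous_inj]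
  refine and_congr_right fun _ => and_congr_right fun _ => and_congr_right fun _ => ?_
  have hJ : ∀ v ∈ leftOrder (component σ A r), ∀ a ∈ jacobsonRadical (leftOrder (component σ A r)),
      v * a ∈ jacobsonRadical (leftOrder (component σ A r)) := by
    rintro v hv _ ⟨w, hw, rfl⟩
    exact ⟨⟨v, hv⟩ * w, Submodule.smul_mem _ _ hw, rfl⟩
  -- The plain product `J(W) J(W)` is the twisted product in degree `0`, where the twist is trivial.
  have h0 : conj (jacobsonRadical (leftOrder (component σ A r))) (aut σ 0) =
      jacobsonRadical (leftOrder (component σ A r)) := by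
    ext x
    have : aut σ 0 x = x := by simp [aut]
    conv_lhs => rw [← this]
    exact apply_mem_conj_iff
  rw [← homogeneous_mul_conj hW hJ, add_zero, homogeneous_inj, h0]

theorem cyclicTypeF_iff : CyclicTypeF σ V r (cyclicPiece σ A r) ↔
    IsKind (degree σ) (cone A) (Multiplicative.ofAdd r) .f := by
  rw [CyclicTypeF, and_iff_right (isGradedExtension_cyclicPiece hA r), component_cyclicPiece_self,
    ← homogeneous_ssubset_iff (σ := σ) (g := r), homogeneous_starClosure, ← piece_cone, IsKind,
    ← not_iff_not, ← star_eq_iff hA.cone_total, Set.ssubset_iff_subset_ne,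
    and_iff_right (subset_star fun y hy => hy.2), not_ne_iff, eq_comm]

include hV in
theorem cyclicTypeG_iff : CyclicTypeG σ V r (cyclicPiece σ A r) ↔
    IsKind (degree σ) (cone A) (Multiplicative.ofAdd r) .g := by
  have hB := isGradedExtension_cyclicPiece hA r
  rw [CyclicTypeG, and_iff_right hB]
  have hp := component_cyclicPiece_self (A := A) r
  rw [IsKind, piece_cone, ← homogeneous_starClosure, homogeneous_inj, hp]
  refine and_congr_right fun _ => ?_
  have key : ∀ n : ℕ, homogeneous σ ((n + 1 : ℕ) * r)
      (starClosure (powerProduct σ V (cyclicPiece σ A r) r (n + 1))) =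
      star (degree σ) (Multiplicative.ofAdd r ^ (n + 1))
        (homogeneous σ r (component σ A r) ^ (n + 1)) := fun n => by
    rw [homogeneous_starClosure, (homogeneous_powerProduct hV hB r n).2, hp, ← ofAdd_nsmul,
      nsmul_eq_mul]
  constructor
  · rintro h n ⟨u, hu⟩
    have h1 : u ∈ star (degree σ) (Multiplicative.ofAdd r ^ (n + 1))
        (homogeneous σ r (component σ A r) ^ (n + 1)) := by
      rw [hu, mem_mul_singleton_iff, mul_inv_cancel]
      exact one_mem_leftStab _
    have hur : u.right = Multiplicative.ofAdd ((n + 1 : ℕ) * r) := by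
      rw [← nsmul_eq_mul, ofAdd_nsmul]
      exact h1.1
    rw [← key, leftStab_homogeneous, ← homogeneous_rightMul u hur, homogeneous_inj] at hu
    exact h (n + 1) (Nat.succ_pos n) ⟨u.left, hu⟩
  · rintro h i hi ⟨c, hc⟩
    obtain ⟨n, rfl⟩ := Nat.exists_eq_add_of_le' hi
    rcases eq_or_ne c 0 with rfl | hc0
    · refine starClosure_ne_bot _ (hc.trans (eq_bot_iff.2 ?_))
      rintro _ ⟨x, -, rfl⟩
      simp
    · refine h n ⟨⟨Units.mk0 c hc0, Multiplicative.ofAdd ((n + 1 : ℕ) * r)⟩, ?_⟩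
      rw [← key, leftStab_homogeneous, hc]
      exact homogeneous_rightMul
        (⟨Units.mk0 c hc0, Multiplicative.ofAdd ((n + 1 : ℕ) * r)⟩ : HomogeneousUnits σ) rfl

include hV in
theorem mul_conj_component_eq_iff (g h : ℚ) :
    component σ A g * conj (component σ A h) (aut σ g) = component σ A (g + h) ↔
      piece (degree σ) (cone A) (Multiplicative.ofAdd g) *
        piece (degree σ) (cone A) (Multiplicative.ofAdd h) =
      piece (degree σ) (cone A) (Multiplicative.ofAdd (g + h)) := by
  rw [piece_cone, piece_cone, piece_cone,
    ← homogeneous_mul_conj hV fun v hv a ha => hA.mul_mem_component g hv ha, homogeneous_inj]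

include hV in
theorem isTypeI_iff : IsTypeI σ V ⊤ A ↔
    ∀ d ∈ {d : Multiplicative ℚ | 0 < d.toAdd}, ∀ e ∈ {d : Multiplicative ℚ | 0 < d.toAdd},
      piece (degree σ) (cone A) d * piece (degree σ) (cone A) e =
        piece (degree σ) (cone A) (d * e) ∧
      piece (degree σ) (cone A) d⁻¹ * piece (degree σ) (cone A) e⁻¹ =
        piece (degree σ) (cone A) (d⁻¹ * e⁻¹) := by
  rw [IsTypeI, and_iff_right hA]
  simp only [sub_eq_add_neg, mul_conj_component_eq_iff hV hA]
  constructor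
  · intro h d hd e he
    exact h d.toAdd trivial e.toAdd trivial hd he
  · intro h g _ k _ hg hk
    exact h _ hg _ hk

end Kinds

theorem exists_common_divisor {d e : ℚ} (hd : 0 < d) (he : 0 < e) :
    ∃ f : ℚ, 0 < f ∧ ∃ m n : ℕ, d = (m + 1 : ℕ) * f ∧ e = (n + 1 : ℕ) * f := by
  have hd' := Rat.num_pos.2 hd
  have he' := Rat.num_pos.2 he
  obtain ⟨m, hm⟩ := Nat.exists_eq_add_of_le' (n := d.num.toNat * e.den) (m := 1)
    (Nat.mul_pos (by omega) e.den_pos)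
  obtain ⟨n, hn⟩ := Nat.exists_eq_add_of_le' (n := e.num.toNat * d.den) (m := 1)
    (Nat.mul_pos (by omega) d.den_pos)
  have hdd : (d.den : ℚ) ≠ 0 := by exact_mod_cast d.den_nz
  have hed : (e.den : ℚ) ≠ 0 := by exact_mod_cast e.den_nz
  have hdn : ((d.num.toNat : ℕ) : ℚ) = d * d.den := by
    rw [Rat.mul_den_eq_num]; exact_mod_cast Int.toNat_of_nonneg hd'.le
  have hen : ((e.num.toNat : ℕ) : ℚ) = e * e.den := by
    rw [Rat.mul_den_eq_num]; exact_mod_cast Int.toNat_of_nonneg he'.le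
  -- Both rationals are positive integer multiples of the reciprocal of the product of their
  -- denominators.
  refine ⟨1 / (d.den * e.den), by positivity, m, n, ?_, ?_⟩
  · rw [← hm]
    push_cast
    rw [hdn]
    field_simp
  · rw [← hn]
    push_cast
    rw [hen]
    field_simp

end GradedExt

theorem theorem3p3 {K : Type*} [DivisionRing K] (V : Subring K)
    (hV : GradedExt.IsTotalValuationRing V) (hVK : V ≠ ⊤)
    (σ : Multiplicative ℚ →* RingAut K) (A : Subring (GradedExt.SkewGroupRing σ))
    (hA : GradedExt.IsGradedExtension σ V ⊤ A) :
    GradedExt.IsTypeI σ V ⊤ A ↔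
      (GradedExt.IsTypeA σ V A ∨ GradedExt.IsTypeB σ V A ∨ GradedExt.IsTypeC σ V A ∨
        GradedExt.IsTypeD σ V A ∨ GradedExt.IsTypeF σ V A ∨ GradedExt.IsTypeG σ V A) := by
  rw [GradedExt.isTypeI_iff hV hA, TotalCone.piece_mul_piece_iff hA.cone_total
    ⟨Multiplicative.ofAdd 1, show (0 : ℚ) < 1 from one_pos⟩]
  · have h : ∀ t, (∀ r : ℚ, 0 < r →
        TotalCone.IsKind (GradedExt.degree σ) (GradedExt.cone A) (Multiplicative.ofAdd r) t) ↔
        ∀ d ∈ {d : Multiplicative ℚ | 0 < d.toAdd},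
          TotalCone.IsKind (GradedExt.degree σ) (GradedExt.cone A) d t := fun t => Iff.rfl
    simp only [GradedExt.IsTypeA, GradedExt.IsTypeB, GradedExt.IsTypeC, GradedExt.IsTypeD,
      GradedExt.IsTypeF, GradedExt.IsTypeG, hA, true_and, GradedExt.cyclicTypeA_iff hA,
      GradedExt.cyclicTypeB_iff hA, GradedExt.cyclicTypeC_iff hA, GradedExt.cyclicTypeD_iff hV hA,
      GradedExt.cyclicTypeF_iff hA, GradedExt.cyclicTypeG_iff hV hA, h]
    constructor
    · rintro ⟨t, ht⟩
      cases t
      exacts [.inl ht, .inr (.inl ht), .inr (.inr (.inl ht)), .inr (.inr (.inr (.inl ht))),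
        .inr (.inr (.inr (.inr (.inl ht)))), .inr (.inr (.inr (.inr (.inr ht))))]
    · rintro (h | h | h | h | h | h) <;> exact ⟨_, h⟩
  · intro d hd n
    exact nsmul_pos (show 0 < Multiplicative.toAdd d from hd) n.succ_ne_zero
  · intro d hd e he
    obtain ⟨f, hf, m, n, hm, hn⟩ := GradedExt.exists_common_divisor hd he
    refine ⟨Multiplicative.ofAdd f, hf, m, n, ?_, ?_⟩
    · rw [← ofAdd_nsmul, nsmul_eq_mul, ← hm, ofAdd_toAdd]
    · rw [← ofAdd_nsmul, nsmul_eq_mul, ← hn, ofAdd_toAdd]
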